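/- Let $d\ge 1$ be an integer and $\alpha<d$ a real number. Place one qubit on each site of the cubic lattice $\{0,\dots,L-1\}^d$, so that there are $N=L^d$ qubits, and let $r_{ij}$ be the Euclidean distance of the sites $i,j$. Consider time-dependent Hamiltonians $H(t)=\sum_P J_P(t)\,P$, where $P$ runs over the Pauli strings on the $N$ qubits and the coefficients $J_P(t)$ are real and integrable in time. Let $H_{i'j'}(t)$ be the part of $H(t)$ that acts on both $i'$ and $j'$, i.e. the sum of all terms $J_P(t)P$ whose support contains $i'$ and $j'$. Call $H$ *admissible* for $(\alpha,K)$ on $[0,T]$ if at all times $t\in[0,T]$ only strings acting on at most $K$ qubits occur and $\|H_{i'j'}(t)\|\le r_{i'j'}^{-\alpha}$ (operator norm) for all $i'\ne j'$; single-qubit terms are not restricted. Write $X_i(T)=U(T)^\dagger X_i U(T)$ with $U(T)=\mathcal T e^{-\mathrm i\int_0^T H(t)\,dt}$, where $X_i$ is the Pauli matrix $X$ on qubit $i$. 1. For every $\delta>0$ there are a locality $K$ and an $L_0$ (depending only on $d,\alpha,\delta$) such that for all $L\ge L_0$ and every pair of distinct qubits $i,j$ there is a Hamiltonian, admissible for $(\alpha,K)$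 on $[0,T]$ with $T=N^{\frac{\alpha}{d}-1+\delta}$, for which $$\big\|[X_i(T),X_j]\big\|\ge 1 .$$ 2. Hence the exponent in the Lieb–Robinson bound $T=\Omega(N^{\frac{\alpha}{d}-1})$ for strongly long-range interactions cannot be improved: for every $\beta>\frac{\alpha}{d}-1$ there is a $K$ for which the following assertion is false: "there are $c>0$ and $L_0$ such that for all $L\ge L_0$, all distinct $i,j$ and all $T\ge 0$, if some Hamiltonian admissible for $(\alpha,K)$ on $[0,T]$ satisfies $\|[X_i(T),X_j]\|\ge1$, then $T\ge cN^{\beta}$." -/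

import Mathlib

open scoped Matrix Matrix.Norms.L2Operator

/-! Matrices carry the L2 operator (spectral) norm throughout. -/

noncomputable section

namespace PowerLawQubits

/-- The sites of the cubic lattice `{0, …, L - 1}^d`; there is one qubit on each site. -/
abbrev Site (d L : ℕ) : Type := Fin d → Fin L

/-- The number `N = L ^ d` of qubits, as a real number. -/
def numQubits (d L : ℕ) : ℝ := (L : ℝ) ^ d

/-- Euclidean distance between two sites. -/
def siteDist {d L : ℕ} (i j : Site d L) : ℝ :=
  Real.sqrt (∑ k, (((i k : ℕ) : ℝ) - ((j k : ℕ) : ℝ)) ^ 2)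

section Qubits

variable {Λ : Type} [Fintype Λ] [DecidableEq Λ]

/-- Operators on the `2 ^ |Λ|`-dimensional Hilbert space of the qubits labelled by `Λ`, as matrices
in the computational basis (indexed by bit strings `Λ → Fin 2`). -/
abbrev QubitOp (Λ : Type) : Type := Matrix (Λ → Fin 2) (Λ → Fin 2) ℂ

/-- The matrices `1, X, Y, Z`, numbered `0, 1, 2, 3`. -/
def pauli (a : Fin 4) : Matrix (Fin 2) (Fin 2) ℂ :=
  match a with
  | 0 => 1
  | 1 => !![0, 1; 1, 0]
  | 2 => !![0, -Complex.I; Complex.I, 0]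
  | 3 => !![1, 0; 0, -1]

/-- The tensor product over all qubits `i` of the matrices `pauli (P i)`. -/
def pauliString (P : Λ → Fin 4) : QubitOp Λ :=
  Matrix.of fun x y => ∏ i, pauli (P i) (x i) (y i)

/-- The set of qubits on which a Pauli string acts nontrivially. -/
def pauliSupport (P : Λ → Fin 4) : Finset Λ := Finset.univ.filter fun i => P i ≠ 0

/-- The Pauli matrix `X` on qubit `i` (identity on all other qubits). -/
def pauliX (i : Λ) : QubitOp Λ := pauliString (Pi.single i 1)

/-- The Hamiltonian `H(t) = ∑_P J_P(t) P`, expanded in Pauli strings with real coefficients. -/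
def hamiltonian (J : ℝ → (Λ → Fin 4) → ℝ) (t : ℝ) : QubitOp Λ :=
  ∑ P : Λ → Fin 4, ((J t P : ℝ) : ℂ) • pauliString P

/-- The part `H_{ij}(t)` of the Hamiltonian that acts on both `i` and `j`: the sum of all terms
whose support contains `i` and `j`. -/
def pairPart (J : ℝ → (Λ → Fin 4) → ℝ) (t : ℝ) (i j : Λ) : QubitOp Λ :=
  ∑ P ∈ Finset.univ.filter (fun P : Λ → Fin 4 => i ∈ pauliSupport P ∧ j ∈ pauliSupport P),
    ((J t P : ℝ) : ℂ) • pauliString P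

/-- `U` is the family of propagators `U(t) = 𝒯 exp (-i ∫₀ᵗ H(s) ds)`, `0 ≤ t ≤ T`, of the integrable
time-dependent Hamiltonian `H`: the continuous solution of the Schrödinger equation in integral
form. -/
structure IsPropagator (H : ℝ → QubitOp Λ) (T : ℝ) (U : ℝ → QubitOp Λ) : Prop where
  integrable : IntervalIntegrable H MeasureTheory.volume 0 T
  continuousOn : ContinuousOn U (Set.Icc 0 T)
  eq_integral : ∀ t ∈ Set.Icc 0 T, U t = 1 - Complex.I • ∫ s in (0 : ℝ)..t, H s * U s

/-- The commutator `[X_i(T), X_j]`, where `X_i(T) = U(T)† X_i U(T)`. -/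
def heisenbergCommutator (U : ℝ → QubitOp Λ) (T : ℝ) (i j : Λ) : QubitOp Λ :=
  ((U T)ᴴ * pauliX i * U T) * pauliX j - pauliX j * ((U T)ᴴ * pauliX i * U T)

end Qubits

/-- A time-dependent `K`-local Hamiltonian on the `d`-dimensional lattice whose pair interactions
obey `‖H_{ij}(t)‖ ≤ r_{ij}^{-α}` at all times in `[0, T]`. Single-qubit terms are unrestricted. -/
structure IsPowerLaw {d L : ℕ} (α : ℝ) (K : ℕ) (T : ℝ)
    (J : ℝ → (Site d L → Fin 4) → ℝ) : Prop where
  isLocal : ∀ t ∈ Set.Icc 0 T, ∀ P, K < (pauliSupport P).card → J t P = 0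
  norm_le : ∀ t ∈ Set.Icc 0 T, ∀ i j : Site d L, i ≠ j →
    ‖pairPart J t i j‖ ≤ siteDist i j ^ (-α)

/-- Some `K`-local power-law Hamiltonian with exponent `α` satisfies `‖[X_i(T), X_j]‖ ≥ 1`. -/
def CanGrow {d L : ℕ} (α : ℝ) (K : ℕ) (T : ℝ) (i j : Site d L) : Prop :=
  ∃ (J : ℝ → (Site d L → Fin 4) → ℝ) (U : ℝ → QubitOp (Site d L)),
    IsPowerLaw α K T J ∧ IsPropagator (hamiltonian J) T U ∧ 1 ≤ ‖heisenbergCommutator U T i j‖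

/-- The assertion that a time `T = Ω(N ^ β)` is necessary for operators to grow, for all `K`-local
power-law Hamiltonians with exponent `α` in dimension `d`. -/
def LiebRobinsonBound (d : ℕ) (α : ℝ) (K : ℕ) (β : ℝ) : Prop :=
  ∃ c : ℝ, 0 < c ∧ ∃ L₀ : ℕ, ∀ L ≥ L₀, ∀ i j : Site d L, i ≠ j → ∀ T : ℝ, 0 ≤ T →
    CanGrow α K T i j → c * numQubits d L ^ β ≤ T

end PowerLawQubits

end

/-! A single qubit can steer a distant one through a short chain of macroscopic clusters that
amplify its signal. Join `j` to `i` by `m` disjoint clusters of `n = 2 * h` qubits each, with `n`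
proportional to `N`, and apply successively the gates `exp (i θ Σ Z_a Y_b)` between neighbours. Such
a gate rotates the collective spin of the second cluster in the Z–X plane by an angle `2 θ` times
the magnetization of the first. If the second cluster is polarized along X, it acquires
magnetization `n sin (2 θ μ)`. With `2 θ = x / n` and `x ^ (m + 1) = n`, each step amplifies the
mean magnetization by a factor between `x / 2` and `x`. After `m` steps it is of order `n / x`,
enough for a last gate with `θ` of order `x / n` to turn qubit `i` onto an eigenstate of X. Flipping
`j` reverses every sign and yields the opposite eigenvalue, so `[X_i(T), X_j]` has norm close to 2
(`one_le_norm_commutator`).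

A product state polarized along X has Z-fluctuations of order `√n`, which would drown the signal.
The clusters are instead prepared in the uniform superposition of bit strings whose bit counts lie
within `W` of half filling. Its magnetization is at most `2 * W`, and it is an approximate
eigenvector of the collective X with relative error `2 / √(W + 1)`, by counting the boundary of the
window (`card_boundary_le`). Relative errors at most double per gate, up to a fixed addition, so for
fixed `m` a large constant `W` and then a large `x` suffice (`exists_schedule`,
`exists_chainOp_commutator`).

All angles are `O(x / n)`, that is `O(N ^ (1 / (m + 1) - 1))`, while pair couplings of order `L ^
(-α) = N ^ (-α / d)` are allowed. The gates therefore take time `O(N ^ (α / d - 1 + 1 / (m + 1)))`,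
which any `δ > 1 / (m + 1)` absorbs for large `L`. Only two-body terms occur, so `K = 2`. -/

set_option linter.unusedSectionVars false

noncomputable section

namespace PowerLawQubits

section Qubits

variable {Λ : Type} [Fintype Λ] [DecidableEq Λ]

/-! ### Pauli strings and collective spins -/

section PauliAlgebra

/-- The tensor product of one single-qubit operator per site. -/
def tensorOp (M : Λ → Matrix (Fin 2) (Fin 2) ℂ) : QubitOp Λ :=
  Matrix.of fun x y => ∏ i, M i (x i) (y i)

lemma tensorOp_mul (M N : Λ → Matrix (Fin 2) (Fin 2) ℂ) :
    tensorOp M * tensorOp N = tensorOp (M * N) := by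
  ext x y
  simp only [tensorOp, Matrix.mul_apply, Matrix.of_apply, Pi.mul_apply]
  rw [Finset.prod_univ_sum, Fintype.piFinset_univ]
  simp only [Finset.prod_mul_distrib]

lemma tensorOp_one : tensorOp (1 : Λ → Matrix (Fin 2) (Fin 2) ℂ) = 1 := by
  ext x y
  simp only [tensorOp, Matrix.of_apply, Pi.one_apply, Matrix.one_apply, Finset.prod_ite_zero,
    Finset.prod_const_one, Finset.mem_univ, true_implies]
  simp only [funext_iff]

lemma conjTranspose_tensorOp (M : Λ → Matrix (Fin 2) (Fin 2) ℂ) :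
    (tensorOp M)ᴴ = tensorOp fun i => (M i)ᴴ := by
  ext x y
  simp [tensorOp, Matrix.conjTranspose_apply]

lemma pauliString_eq_tensorOp (P : Λ → Fin 4) :
    pauliString P = tensorOp fun i => pauli (P i) := rfl

lemma pauli_mul_self (p : Fin 4) : pauli p * pauli p = 1 := by
  fin_cases p <;> ext a b <;> fin_cases a <;> fin_cases b <;> simp [pauli, Matrix.mul_apply]

lemma conjTranspose_pauli (p : Fin 4) : (pauli p)ᴴ = pauli p := by
  fin_cases p <;> ext a b <;> fin_cases a <;> fin_cases b <;>
    simp [pauli, Matrix.conjTranspose_apply]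

lemma conjTranspose_pauliString (P : Λ → Fin 4) : (pauliString P)ᴴ = pauliString P := by
  simp only [pauliString_eq_tensorOp, conjTranspose_tensorOp, conjTranspose_pauli]

lemma pauliString_mul_self (P : Λ → Fin 4) : pauliString P * pauliString P = 1 := by
  rw [pauliString_eq_tensorOp, tensorOp_mul, ← tensorOp_one]
  congr 1
  funext i
  exact pauli_mul_self (P i)

lemma norm_pauliString (P : Λ → Fin 4) : ‖pauliString P‖ = 1 := by
  refine CStarRing.norm_of_mem_unitary ?_
  rw [Unitary.mem_iff, Matrix.star_eq_conjTranspose, conjTranspose_pauliString]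
  exact ⟨pauliString_mul_self P, pauliString_mul_self P⟩

/-- The single-qubit operator `M` acting on the site `a`. -/
def siteOp (a : Λ) (M : Matrix (Fin 2) (Fin 2) ℂ) : QubitOp Λ := tensorOp (Pi.mulSingle a M)

lemma siteOp_mul (a : Λ) (M N : Matrix (Fin 2) (Fin 2) ℂ) :
    siteOp a M * siteOp a N = siteOp a (M * N) := by
  rw [siteOp, siteOp, tensorOp_mul, ← Pi.mulSingle_mul, siteOp]

lemma siteOp_commute {a b : Λ} (h : a ≠ b) (M N : Matrix (Fin 2) (Fin 2) ℂ) :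
    Commute (siteOp a M) (siteOp b N) := by
  rw [commute_iff_eq, siteOp, siteOp, tensorOp_mul, tensorOp_mul]
  congr 1
  funext i
  by_cases hi : i = a
  · subst hi
    simp [Pi.mulSingle_eq_of_ne h]
  · simp [Pi.mulSingle_eq_of_ne hi]

lemma siteOp_apply (a : Λ) (M : Matrix (Fin 2) (Fin 2) ℂ) (x y : Λ → Fin 2) :
    siteOp a M x y = if ∀ b, b ≠ a → x b = y b then M (x a) (y a) else 0 := by
  simp only [siteOp, tensorOp, Matrix.of_apply]
  rw [← Finset.mul_prod_erase _ _ (Finset.mem_univ a), Pi.mulSingle_eq_same]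
  have : ∏ i ∈ Finset.univ.erase a,
      (Pi.mulSingle a M : Λ → Matrix (Fin 2) (Fin 2) ℂ) i (x i) (y i) =
      ∏ i ∈ Finset.univ.erase a, if x i = y i then (1 : ℂ) else 0 := by
    refine Finset.prod_congr rfl fun i hi => ?_
    rw [Pi.mulSingle_eq_of_ne (Finset.ne_of_mem_erase hi), Matrix.one_apply]
  rw [this, Finset.prod_ite_zero]
  simp

lemma siteOp_smul (a : Λ) (c : ℂ) (M : Matrix (Fin 2) (Fin 2) ℂ) :
    siteOp a (c • M) = c • siteOp a M := by
  ext x y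
  simp [siteOp_apply]

lemma siteOp_add (a : Λ) (M N : Matrix (Fin 2) (Fin 2) ℂ) :
    siteOp a (M + N) = siteOp a M + siteOp a N := by
  ext x y
  simp only [siteOp_apply, Matrix.add_apply]
  split_ifs <;> simp

lemma pauliString_single (a : Λ) (p : Fin 4) :
    pauliString (Pi.single a p) = siteOp a (pauli p) := by
  rw [pauliString_eq_tensorOp, siteOp]
  congr 1
  funext i
  by_cases h : i = a
  · subst h; simp
  · rw [Pi.single_eq_of_ne h, Pi.mulSingle_eq_of_ne h]; rfl

lemma norm_siteOp_pauli (a : Λ) (p : Fin 4) : ‖siteOp a (pauli p)‖ = 1 := by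
  rw [← pauliString_single, norm_pauliString]

lemma conjTranspose_siteOp_pauli (a : Λ) (p : Fin 4) :
    (siteOp a (pauli p))ᴴ = siteOp a (pauli p) := by
  rw [← pauliString_single, conjTranspose_pauliString]

/-- The collective spin operator: the sum over the sites of `C` of the Pauli matrix `p`. -/
def spin (p : Fin 4) (C : Finset Λ) : QubitOp Λ := ∑ a ∈ C, siteOp a (pauli p)

lemma conjTranspose_spin (p : Fin 4) (C : Finset Λ) : (spin p C)ᴴ = spin p C := by
  simp only [spin, Matrix.conjTranspose_sum, conjTranspose_siteOp_pauli]

lemma spin_singleton (p : Fin 4) (a : Λ) : spin p {a} = siteOp a (pauli p) := by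
  simp [spin]

lemma norm_spin_le (p : Fin 4) (C : Finset Λ) : ‖spin p C‖ ≤ C.card := by
  refine (norm_sum_le _ _).trans ?_
  simp [norm_siteOp_pauli]

lemma spin_commute {C D : Finset Λ} (h : Disjoint C D) (p q : Fin 4) :
    Commute (spin p C) (spin q D) := by
  refine Commute.sum_left _ _ _ fun a ha => Commute.sum_right _ _ _ fun b hb => ?_
  exact siteOp_commute (ne_of_mem_of_not_mem hb (Finset.disjoint_left.mp h ha)).symm _ _

/-- Collective commutation relations follow from those of a single qubit. -/
lemma spin_mul_sub (p q r : Fin 4) (c : ℂ)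
    (h : pauli p * pauli q = pauli q * pauli p + c • pauli r) (C : Finset Λ) :
    spin p C * spin q C = spin q C * spin p C + c • spin r C := by
  simp only [spin, Finset.sum_mul_sum, Finset.smul_sum]
  rw [Finset.sum_comm (s := C) (t := C) (f := fun i j => siteOp i (pauli q) * siteOp j (pauli p)),
    ← Finset.sum_add_distrib]
  refine Finset.sum_congr rfl fun a ha => ?_
  rw [← Finset.add_sum_erase C _ ha, ← Finset.add_sum_erase C
    (fun j => siteOp j (pauli q) * siteOp a (pauli p)) ha]
  have : ∑ x ∈ C.erase a, siteOp a (pauli p) * siteOp x (pauli q) =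
      ∑ x ∈ C.erase a, siteOp x (pauli q) * siteOp a (pauli p) :=
    Finset.sum_congr rfl fun b hb =>
      (siteOp_commute (Finset.ne_of_mem_erase hb).symm _ _).eq
  rw [this, siteOp_mul, h, siteOp_add, siteOp_smul, siteOp_mul]
  abel

/-- The eigenvalue of the collective `Z` operator at the bit string `x`. -/
def magnetization (C : Finset Λ) (x : Λ → Fin 2) : ℝ := ∑ a ∈ C, if x a = 0 then 1 else -1

lemma siteOp_pauliZ (a : Λ) :
    siteOp a (pauli 3) = Matrix.diagonal fun x => if x a = 0 then 1 else -1 := by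
  ext x y
  rw [siteOp_apply, Matrix.diagonal_apply]
  by_cases hxy : x = y
  · subst hxy
    rcases Fin.exists_fin_two.mp ⟨x a, rfl⟩ with h | h <;> simp [h, pauli]
  · rw [if_neg hxy]
    split_ifs with h
    · have : x a ≠ y a := fun ha => hxy (funext fun b => by
        by_cases hb : b = a
        · rw [hb, ha]
        · exact h b hb)
      generalize x a = s at *
      generalize y a = t at *
      fin_cases s <;> fin_cases t <;> simp [pauli] at *
    · rfl

lemma spin_three_eq_diagonal (C : Finset Λ) :
    spin 3 C = Matrix.diagonal fun x => (magnetization C x : ℂ) := by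
  simp only [spin, siteOp_pauliZ, magnetization]
  ext x y
  rw [Matrix.sum_apply]
  by_cases h : x = y
  · subst h
    simp [apply_ite]
  · simp [h]

/-- The bit string `x` with the bit at the site `a` flipped. -/
def flip (a : Λ) (x : Λ → Fin 2) : Λ → Fin 2 := Function.update x a (x a + 1)

lemma siteOp_pauliX_apply (a : Λ) (x y : Λ → Fin 2) :
    siteOp a (pauli 1) x y = if y = flip a x then 1 else 0 := by
  rw [siteOp_apply]
  by_cases h : ∀ b, b ≠ a → x b = y b
  · rw [if_pos h]
    have : y = flip a x ↔ y a = x a + 1 := by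
      constructor
      · intro e; rw [e]; simp [flip]
      · intro e
        funext b
        by_cases hb : b = a
        · subst hb; simp [flip, e]
        · simp [flip, hb, h b hb]
    rw [if_congr this rfl rfl]
    generalize x a = s
    generalize y a = t
    fin_cases s <;> fin_cases t <;> simp [pauli]
  · rw [if_neg h, if_neg]
    intro e
    exact h fun b hb => by rw [e]; simp [flip, hb]

end PauliAlgebra

/-! ### Propagators of constant and concatenated Hamiltonians -/

section Propagators

open MeasureTheory Set

/-- The unitary `V` is the time-`T` propagator of some time-dependent Hamiltonian whose
coefficients belong to `D` at all times. -/
def Reaches (D : Set ((Λ → Fin 4) → ℝ)) (T : ℝ) (V : QubitOp Λ) : Prop :=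
  ∃ (J : ℝ → (Λ → Fin 4) → ℝ) (U : ℝ → QubitOp Λ),
    (∀ t ∈ Icc 0 T, J t ∈ D) ∧ IsPropagator (hamiltonian J) T U ∧ U T = V

lemma reaches_const {D : Set ((Λ → Fin 4) → ℝ)} {c : (Λ → Fin 4) → ℝ} (hc : c ∈ D) (T : ℝ) :
    Reaches D T (NormedSpace.exp (T • (-Complex.I • ∑ P, (c P : ℂ) • pauliString P))) := by
  set X : QubitOp Λ := -Complex.I • ∑ P, (c P : ℂ) • pauliString P with hX
  have hd : ∀ t : ℝ, HasDerivAt (fun u : ℝ => NormedSpace.exp (u • X))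
      (X * NormedSpace.exp (t • X)) t := fun t => hasDerivAt_exp_smul_const' X t
  have hcont : Continuous fun u : ℝ => NormedSpace.exp (u • X) :=
    continuous_iff_continuousAt.mpr fun t => (hd t).continuousAt
  refine ⟨fun _ => c, fun t => NormedSpace.exp (t • X), fun _ _ => hc, ⟨?_, ?_, ?_⟩, rfl⟩
  · exact intervalIntegrable_const
  · exact hcont.continuousOn
  · intro t _
    have h1 : ∫ s in (0 : ℝ)..t, X * NormedSpace.exp (s • X) =
        NormedSpace.exp (t • X) - NormedSpace.exp ((0 : ℝ) • X) :=
      intervalIntegral.integral_eq_sub_of_hasDerivAt (fun s _ => hd s)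
        ((continuous_const.mul hcont).intervalIntegrable _ _)
    rw [zero_smul, NormedSpace.exp_zero] at h1
    have h2 : ∀ s : ℝ, X * NormedSpace.exp (s • X) =
        -Complex.I • (hamiltonian (fun _ => c) s * NormedSpace.exp (s • X)) := by
      intro s
      rw [hX, smul_mul_assoc]
      rfl
    simp only [h2] at h1
    rw [intervalIntegral.integral_smul] at h1
    rw [sub_eq_add_neg, ← neg_smul, h1]
    abel

/-- The second Hamiltonian is run after the first, delayed by `T₁`. Right multiplication by the
constant `U₁ T₁` passes through the integral equation. No continuity in time is required at the
junction, only integrability. -/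
lemma Reaches.trans {D : Set ((Λ → Fin 4) → ℝ)} {T₁ T₂ : ℝ} {V₁ V₂ : QubitOp Λ}
    (h₁ : Reaches D T₁ V₁) (h₂ : Reaches D T₂ V₂) (hT₁ : 0 ≤ T₁) (hT₂ : 0 ≤ T₂) :
    Reaches D (T₁ + T₂) (V₂ * V₁) := by
  obtain ⟨J₁, U₁, hJ₁, hU₁, rfl⟩ := h₁
  obtain ⟨J₂, U₂, hJ₂, hU₂, rfl⟩ := h₂
  have hU₂0 : U₂ 0 = 1 := by
    have := hU₂.eq_integral 0 ⟨le_rfl, hT₂⟩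
    simpa using this
  set J : ℝ → (Λ → Fin 4) → ℝ := fun t => if t ≤ T₁ then J₁ t else J₂ (t - T₁) with hJ
  set U : ℝ → QubitOp Λ := fun t => if t ≤ T₁ then U₁ t else U₂ (t - T₁) * U₁ T₁ with hU
  have hH₁ : ∀ t, t ≤ T₁ → hamiltonian J t = hamiltonian J₁ t := fun t ht => by
    simp only [hamiltonian, hJ, if_pos ht]
  have hH₂ : ∀ t, T₁ < t → hamiltonian J t = hamiltonian J₂ (t - T₁) := fun t ht => by
    simp only [hamiltonian, hJ, if_neg (not_le.mpr ht)]
  have hUU₁ : ∀ t, t ≤ T₁ → U t = U₁ t := fun t ht => by simp only [hU, if_pos ht]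
  have hUU₂ : ∀ t, T₁ ≤ t → U t = U₂ (t - T₁) * U₁ T₁ := fun t ht => by
    rcases ht.eq_or_lt with rfl | ht
    · simp [hU, hU₂0]
    · simp only [hU, if_neg (not_le.mpr ht)]
  have hint₁ : IntervalIntegrable (hamiltonian J) volume 0 T₁ := by
    refine hU₁.integrable.congr ?_
    rw [uIoc_of_le hT₁]
    exact fun t ht => (hH₁ t ht.2).symm
  have hint₂ : IntervalIntegrable (hamiltonian J) volume T₁ (T₁ + T₂) := by
    have h := hU₂.integrable.comp_sub_right T₁
    rw [zero_add, add_comm T₂] at h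
    refine h.congr ?_
    rw [uIoc_of_le (by linarith)]
    exact fun t ht => (hH₂ t ht.1).symm
  have hcont : ContinuousOn U (Icc 0 (T₁ + T₂)) := by
    rw [← Icc_union_Icc_eq_Icc hT₁ (by linarith : T₁ ≤ T₁ + T₂)]
    refine ContinuousOn.union_of_isClosed ?_ ?_ isClosed_Icc isClosed_Icc
    · exact hU₁.continuousOn.congr fun t ht => hUU₁ t ht.2
    · have h : ContinuousOn (fun t => U₂ (t - T₁) * U₁ T₁) (Icc T₁ (T₁ + T₂)) := by
        refine ContinuousOn.mul (hU₂.continuousOn.comp (by fun_prop) fun t ht => ?_)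
          continuousOn_const
        exact ⟨by linarith [ht.1], by linarith [ht.2]⟩
      exact h.congr fun t ht => hUU₂ t ht.1
  have hHU : ∀ {a b}, 0 ≤ a → a ≤ b → b ≤ T₁ + T₂ →
      IntervalIntegrable (fun s => hamiltonian J s * U s) volume a b := by
    intro a b ha hab hb
    have h := (hint₁.trans hint₂).mono_set (c := a) (d := b) (by
      rw [uIcc_of_le hab, uIcc_of_le (by linarith)]
      exact Icc_subset_Icc ha hb)
    refine h.mul_continuousOn (hcont.mono ?_)
    rw [uIcc_of_le hab]
    exact Icc_subset_Icc ha hb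
  have key₁ : ∀ t ∈ Icc 0 T₁, U t = 1 - Complex.I • ∫ s in (0 : ℝ)..t, hamiltonian J s * U s := by
    intro t ht
    rw [hUU₁ t ht.2, hU₁.eq_integral t ht]
    congr 2
    refine intervalIntegral.integral_congr fun s hs => ?_
    rw [uIcc_of_le ht.1] at hs
    simp only [hH₁ s (hs.2.trans ht.2), hUU₁ s (hs.2.trans ht.2)]
  refine ⟨J, U, ?_, ⟨hint₁.trans hint₂, hcont, ?_⟩, ?_⟩
  · intro t ht
    by_cases h : t ≤ T₁
    · simp only [hJ, if_pos h]
      exact hJ₁ t ⟨ht.1, h⟩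
    · simp only [hJ, if_neg h]
      exact hJ₂ _ ⟨by linarith, by linarith [ht.2]⟩
  · intro t ht
    rcases le_total t T₁ with h | h
    · exact key₁ t ⟨ht.1, h⟩
    · rw [← intervalIntegral.integral_add_adjacent_intervals
        (hHU le_rfl hT₁ (by linarith)) (hHU hT₁ h ht.2), smul_add, ← sub_sub,
        ← key₁ T₁ ⟨hT₁, le_rfl⟩, hUU₁ T₁ le_rfl, hUU₂ t h,
        hU₂.eq_integral (t - T₁) ⟨by linarith, by linarith [ht.2]⟩, sub_mul, one_mul,
        smul_mul_assoc]
      congr 2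
      have h1 : ∫ s in T₁..t, hamiltonian J s * U s =
          ∫ s in T₁..t, (hamiltonian J₂ (s - T₁) * U₂ (s - T₁)) * U₁ T₁ := by
        -- The half-open interval excludes `T₁`, where `J` still takes the value of `J₁`.
        refine intervalIntegral.integral_congr_ae (Filter.Eventually.of_forall fun s hs => ?_)
        rw [uIoc_of_le h] at hs
        rw [hH₂ s hs.1, hUU₂ s hs.1.le, mul_assoc]
      rw [h1, intervalIntegral.integral_comp_sub_right
        (fun s => hamiltonian J₂ s * U₂ s * U₁ T₁), sub_self]
      have hint : IntervalIntegrable (fun s => hamiltonian J₂ s * U₂ s) volume 0 (t - T₁) := by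
        have hsub : uIcc 0 (t - T₁) ⊆ Icc 0 T₂ := by
          rw [uIcc_of_le (by linarith)]
          exact Icc_subset_Icc le_rfl (by linarith [ht.2])
        refine (hU₂.integrable.mono_set ?_).mul_continuousOn (hU₂.continuousOn.mono hsub)
        rwa [uIcc_of_le hT₂]
      exact (((ContinuousLinearMap.mul ℝ (QubitOp Λ)).flip (U₁ T₁)).intervalIntegral_comp_comm
        hint).symm
  · rw [hUU₂ _ (by linarith)]
    simp

end Propagators

/-! ### Conjugation by a controlled rotation -/

section Rotation

/-- `L` is a ladder operator for `B`: moving it to the left past `B + c` leaves `B`. Hence it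
intertwines `z A B + z c A` with `z A B`, and so their exponentials; the extra factor splits off
because `A` commutes with `B`. -/
lemma mul_exp_of_commutator {A B L : QubitOp Λ} {z c : ℂ} (hAB : Commute A B) (hAL : Commute A L)
    (hBL : B * L = L * B + c • L) :
    L * NormedSpace.exp (z • (A * B)) =
      NormedSpace.exp (z • (A * B)) * L * NormedSpace.exp (-(z * c) • A) := by
  have hs : SemiconjBy L (z • (A * B) + (z * c) • A) (z • (A * B)) := by
    rw [SemiconjBy, mul_add, mul_smul_comm, mul_smul_comm, smul_mul_assoc, mul_assoc A B L, hBL,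
      mul_add, mul_smul_comm, smul_add, smul_smul, ← hAL.eq, ← mul_assoc L A B, ← hAL.eq,
      mul_assoc A L B]
  have hc : Commute (z • (A * B)) ((z * c) • A) :=
    (((Commute.refl A).mul_left hAB.symm).smul_left _).smul_right _
  let +nondep : NormedAlgebra ℚ (QubitOp Λ) := .restrictScalars ℚ ℂ (QubitOp Λ)
  have he := hs.exp_right
  rw [NormedSpace.exp_add_of_commute hc] at he
  rw [← he.eq, mul_assoc L, mul_assoc (NormedSpace.exp _), neg_smul,
    ← NormedSpace.exp_add_of_commute (Commute.neg_right (Commute.refl _)), add_neg_cancel,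
    NormedSpace.exp_zero, mul_one]

/-- The operator `f(A)` for the diagonal operator `A` with real eigenvalues `a`. -/
def diagFun (f : ℝ → ℝ) (a : (Λ → Fin 2) → ℝ) : QubitOp Λ :=
  Matrix.diagonal fun x => (f (a x) : ℂ)

/-- A matrix commuting with a diagonal one has nonzero entries only between equal eigenvalues, and
there any function of the eigenvalue agrees too. -/
lemma diagFun_commute {a : (Λ → Fin 2) → ℝ} {P : QubitOp Λ}
    (h : Commute (Matrix.diagonal fun x => (a x : ℂ)) P) (f : ℝ → ℝ) :
    Commute (diagFun f a) P := by
  have h' := h.eq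
  rw [commute_iff_eq, diagFun]
  ext x y
  have hxy := congrFun (congrFun h' x) y
  rw [Matrix.diagonal_mul, Matrix.mul_diagonal] at hxy ⊢
  by_cases hP : P x y = 0
  · simp [hP]
  · rw [mul_comm] at hxy
    have : a x = a y := by exact_mod_cast mul_left_cancel₀ hP hxy
    rw [this, mul_comm]

lemma exp_smul_diagonal (a : (Λ → Fin 2) → ℝ) (r : ℝ) :
    NormedSpace.exp ((Complex.I * r) • (Matrix.diagonal fun x => (a x : ℂ)) : QubitOp Λ) =
      diagFun (fun s => Real.cos (r * s)) a + Complex.I • diagFun (fun s => Real.sin (r * s)) a := by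
  rw [← Matrix.diagonal_smul, Matrix.exp_diagonal, diagFun, diagFun, ← Matrix.diagonal_smul,
    Matrix.diagonal_add]
  congr 1
  funext x
  rw [Pi.coe_exp, ← Complex.exp_eq_exp_ℂ]
  simp only [Pi.smul_apply, smul_eq_mul, Complex.ofReal_cos, Complex.ofReal_sin]
  rw [mul_assoc, mul_comm Complex.I, Complex.exp_mul_I]
  push_cast
  ring

/-- Rotation of a collective spin: conjugation by `exp (i θ A B)`, where `A` is diagonal and `B`
generates the rotation in the plane of `P` and `R`. -/
lemma rotation {a : (Λ → Fin 2) → ℝ} {B P R : QubitOp Λ} (θ : ℝ)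
    (hB : Commute (Matrix.diagonal fun x => (a x : ℂ)) B)
    (hP : Commute (Matrix.diagonal fun x => (a x : ℂ)) P)
    (hR : Commute (Matrix.diagonal fun x => (a x : ℂ)) R)
    (hBP : B * P = P * B + (2 * Complex.I) • R) (hBR : B * R = R * B + (-2 * Complex.I) • P) :
    let V := NormedSpace.exp ((Complex.I * θ) • ((Matrix.diagonal fun x => (a x : ℂ)) * B))
    let c := diagFun (fun s => Real.cos (2 * θ * s)) a
    let s := diagFun (fun s => Real.sin (2 * θ * s)) a
    P * V = V * (c * P + s * R) ∧ R * V = V * (c * R - s * P) := by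
  intro V c s
  have hI : Complex.I * Complex.I = -1 := Complex.I_mul_I
  -- `P ± i R` are ladder operators of `B` with eigenvalues `±2`, so they pick up the phases `exp (∓
  -- 2 i θ A)`. Half the sum and difference of the two relations give the cosine and sine.
  have h1 := mul_exp_of_commutator (z := Complex.I * θ) (c := 2) (L := P + Complex.I • R) hB
    (hP.add_right (hR.smul_right _)) (by
      simp only [mul_add, add_mul, mul_smul_comm, smul_mul_assoc, hBP, hBR, smul_add, smul_smul]
      rw [show Complex.I * (-2 * Complex.I) = 2 by linear_combination -2 * hI]
      abel)
  have h2 := mul_exp_of_commutator (z := Complex.I * θ) (c := -2) (L := P - Complex.I • R) hB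
    (hP.sub_right (hR.smul_right _)) (by
      simp only [mul_sub, sub_mul, mul_smul_comm, smul_mul_assoc, hBP, hBR, smul_add, smul_sub,
        smul_smul]
      rw [show Complex.I * (-2 * Complex.I) = 2 by linear_combination -2 * hI,
        show -2 * Complex.I = -(2 * Complex.I) by ring]
      simp only [neg_smul]
      abel)
  have e1 : NormedSpace.exp (-(Complex.I * θ * 2) • (Matrix.diagonal fun x => (a x : ℂ)) :
      QubitOp Λ) = c - Complex.I • s := by
    have := exp_smul_diagonal a (-(2 * θ))
    rw [show Complex.I * ((-(2 * θ) : ℝ) : ℂ) = -(Complex.I * θ * 2) by push_cast; ring] at this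
    rw [this]
    simp only [neg_mul, Real.cos_neg, Real.sin_neg]
    rw [sub_eq_add_neg, ← smul_neg]
    congr 2
    simp only [s, diagFun, Complex.ofReal_neg, Matrix.diagonal_neg]
  have e2 : NormedSpace.exp (-(Complex.I * θ * -2) • (Matrix.diagonal fun x => (a x : ℂ)) :
      QubitOp Λ) = c + Complex.I • s := by
    have := exp_smul_diagonal a (2 * θ)
    rw [show Complex.I * ((2 * θ : ℝ) : ℂ) = -(Complex.I * θ * -2) by push_cast; ring] at this
    exact this
  rw [e1, mul_assoc] at h1
  rw [e2, mul_assoc] at h2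
  change (P + Complex.I • R) * V = V * _ at h1
  change (P - Complex.I • R) * V = V * _ at h2
  have hcP : c * P = P * c := (diagFun_commute hP _).eq
  have hsP : s * P = P * s := (diagFun_commute hP _).eq
  have hcR : c * R = R * c := (diagFun_commute hR _).eq
  have hsR : s * R = R * s := (diagFun_commute hR _).eq
  rw [hcP, hsP, hcR, hsR]
  simp only [add_mul, sub_mul, mul_add, mul_sub, smul_mul_assoc, mul_smul_comm, smul_add,
    smul_sub, smul_smul, hI, neg_smul, one_smul, mul_neg] at h1 h2 ⊢
  constructor
  · have h3 : (2 : ℂ) • (P * V) = (2 : ℂ) • (V * (P * c) + V * (R * s)) := by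
      linear_combination (norm := module) h1 + h2
    exact smul_right_injective _ two_ne_zero h3
  · have h3 : (2 * Complex.I) • (R * V) = (2 * Complex.I) • (V * (R * c) - V * (P * s)) := by
      linear_combination (norm := module) h1 - h2
    exact smul_right_injective _ (by simp) h3

end Rotation

/-! ### Operators acting on states, and concentration -/

section States

/-- The action of an operator on a state. -/
def act (M : QubitOp Λ) (ψ : EuclideanSpace ℂ (Λ → Fin 2)) : EuclideanSpace ℂ (Λ → Fin 2) :=
  Matrix.toEuclideanCLM (𝕜 := ℂ) M ψ

lemma act_mul (M N : QubitOp Λ) (ψ : EuclideanSpace ℂ (Λ → Fin 2)) :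
    act (M * N) ψ = act M (act N ψ) := by simp [act]

lemma act_one (ψ : EuclideanSpace ℂ (Λ → Fin 2)) : act 1 ψ = ψ := by simp [act]

lemma act_add (M N : QubitOp Λ) (ψ : EuclideanSpace ℂ (Λ → Fin 2)) :
    act (M + N) ψ = act M ψ + act N ψ := by simp [act]

lemma act_sub (M N : QubitOp Λ) (ψ : EuclideanSpace ℂ (Λ → Fin 2)) :
    act (M - N) ψ = act M ψ - act N ψ := by simp [act]

lemma act_smul (c : ℂ) (M : QubitOp Λ) (ψ : EuclideanSpace ℂ (Λ → Fin 2)) :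
    act (c • M) ψ = c • act M ψ := by simp [act]

lemma act_vec_sub (M : QubitOp Λ) (φ ψ : EuclideanSpace ℂ (Λ → Fin 2)) :
    act M (φ - ψ) = act M φ - act M ψ := by simp [act]

lemma act_vec_smul (M : QubitOp Λ) (c : ℂ) (ψ : EuclideanSpace ℂ (Λ → Fin 2)) :
    act M (c • ψ) = c • act M ψ := by simp [act]

lemma norm_act_le (M : QubitOp Λ) (ψ : EuclideanSpace ℂ (Λ → Fin 2)) :
    ‖act M ψ‖ ≤ ‖M‖ * ‖ψ‖ :=
  (Matrix.toEuclideanCLM (𝕜 := ℂ) M).le_opNorm ψ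

lemma act_apply (M : QubitOp Λ) (ψ : EuclideanSpace ℂ (Λ → Fin 2)) (x : Λ → Fin 2) :
    act M ψ x = ∑ y, M x y * ψ y := rfl

lemma norm_act_le_of_mem_unitary {V : QubitOp Λ} (hV : V ∈ unitary (QubitOp Λ))
    (ψ : EuclideanSpace ℂ (Λ → Fin 2)) : ‖act V ψ‖ ≤ ‖ψ‖ := by
  simpa [CStarRing.norm_of_mem_unitary hV] using norm_act_le V ψ

lemma norm_act_of_mem_unitary {V : QubitOp Λ} (hV : V ∈ unitary (QubitOp Λ))
    (ψ : EuclideanSpace ℂ (Λ → Fin 2)) : ‖act V ψ‖ = ‖ψ‖ := by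
  refine le_antisymm (norm_act_le_of_mem_unitary hV ψ) ?_
  have h := norm_act_le_of_mem_unitary (Unitary.star_mem hV) (act V ψ)
  rwa [← act_mul, (Unitary.mem_iff.mp hV).1, act_one] at h

lemma act_diagonal_apply (v : (Λ → Fin 2) → ℂ) (ψ : EuclideanSpace ℂ (Λ → Fin 2))
    (x : Λ → Fin 2) : act (Matrix.diagonal v) ψ x = v x * ψ x := by
  rw [act_apply, Finset.sum_eq_single x] <;> simp +contextual [eq_comm]

lemma norm_le_of_norm_apply_le {φ ψ : EuclideanSpace ℂ (Λ → Fin 2)} {c : ℝ} (hc : 0 ≤ c)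
    (h : ∀ x, ‖φ x‖ ≤ c * ‖ψ x‖) : ‖φ‖ ≤ c * ‖ψ‖ := by
  refine abs_le_of_sq_le_sq' ?_ (by positivity) |>.2
  rw [mul_pow, EuclideanSpace.norm_sq_eq, EuclideanSpace.norm_sq_eq, Finset.mul_sum]
  refine Finset.sum_le_sum fun x _ => ?_
  rw [← mul_pow]
  exact pow_le_pow_left₀ (norm_nonneg _) (h x) 2

/-- A Lipschitz function of a diagonal operator is as concentrated as the operator. -/
lemma norm_diagFun_sub_le {f : ℝ → ℝ} {K : ℝ} (hK : 0 ≤ K) (a : (Λ → Fin 2) → ℝ) (μ : ℝ)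
    (hf : ∀ s, |f s - f μ| ≤ K * |s - μ|) (ψ : EuclideanSpace ℂ (Λ → Fin 2)) :
    ‖act (diagFun f a) ψ - (f μ : ℂ) • ψ‖ ≤
      K * ‖act (Matrix.diagonal fun x => (a x : ℂ)) ψ - (μ : ℂ) • ψ‖ := by
  refine norm_le_of_norm_apply_le hK fun x => ?_
  rw [PiLp.sub_apply, PiLp.sub_apply, diagFun, act_diagonal_apply, act_diagonal_apply,
    PiLp.smul_apply, PiLp.smul_apply, smul_eq_mul, smul_eq_mul, ← sub_mul, ← sub_mul, norm_mul,
    norm_mul, ← mul_assoc]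
  refine mul_le_mul_of_nonneg_right ?_ (norm_nonneg _)
  rw [← Complex.ofReal_sub, ← Complex.ofReal_sub, Complex.norm_real, Complex.norm_real]
  exact hf _

lemma norm_diagFun_le {f : ℝ → ℝ} (hf : ∀ s, |f s| ≤ 1) (a : (Λ → Fin 2) → ℝ) :
    ‖(diagFun f a : QubitOp Λ)‖ ≤ 1 := by
  rw [diagFun, Matrix.l2_opNorm_diagonal]
  refine (pi_norm_le_iff_of_nonneg zero_le_one).mpr fun x => ?_
  rw [Complex.norm_real]
  exact hf _

end States

/-! ### Counting bit strings by layers of the hypercube -/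

section Counting

/-- The number of sites of `D` at which the bit string `x` has the bit `b`. -/
def bitCount (b : Fin 2) (D : Finset Λ) (x : Λ → Fin 2) : ℕ := (D.filter fun a => x a = b).card

lemma flip_flip (a : Λ) (x : Λ → Fin 2) : flip a (flip a x) = x := by
  funext c
  by_cases h : c = a
  · subst h
    simp only [flip, Function.update_self]
    generalize x c = s
    fin_cases s <;> rfl
  · simp [flip, h]

lemma flip_of_ne {a c : Λ} (h : c ≠ a) (x : Λ → Fin 2) : flip a x c = x c := by
  simp [flip, h]

lemma flip_injective (x : Λ → Fin 2) : Function.Injective fun a => flip a x := by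
  intro a c h
  by_contra hac
  have h1 := congrFun h a
  simp only [flip_of_ne hac] at h1
  simp only [flip, Function.update_self] at h1
  generalize x a = s at h1
  fin_cases s <;> simp at h1

/-- A flip changes the count by one; corrections are added on both sides to avoid truncated
subtraction. -/
lemma bitCount_flip {D : Finset Λ} {a : Λ} (ha : a ∈ D) (b : Fin 2) (x : Λ → Fin 2) :
    bitCount b D (flip a x) + (if x a = b then 1 else 0) =
      bitCount b D x + (if x a = b then 0 else 1) := by
  have h : ∀ y : Λ → Fin 2, bitCount b D y =
      bitCount b (D.erase a) y + if y a = b then 1 else 0 := by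
    intro y
    simp only [bitCount, Finset.card_filter]
    rw [Finset.sum_erase_add _ _ ha]
  have h2 : bitCount b (D.erase a) (flip a x) = bitCount b (D.erase a) x := by
    simp only [bitCount]
    congr 1
    refine Finset.filter_congr fun c hc => ?_
    rw [flip_of_ne (Finset.ne_of_mem_erase hc)]
  have h3 : flip a x a = b ↔ ¬ x a = b := by
    simp only [flip, Function.update_self]
    generalize x a = s
    fin_cases s <;> fin_cases b <;> simp
  rw [h, h x, h2, if_congr h3 rfl rfl]
  split_ifs <;> omega

lemma bitCount_flip_of_notMem {D : Finset Λ} {a : Λ} (ha : a ∉ D) (b : Fin 2) (x : Λ → Fin 2) :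
    bitCount b D (flip a x) = bitCount b D x := by
  simp only [bitCount]
  congr 1
  refine Finset.filter_congr fun c hc => ?_
  rw [flip_of_ne (ne_of_mem_of_not_mem hc ha)]

lemma bitCount_add (b : Fin 2) (D : Finset Λ) (x : Λ → Fin 2) :
    bitCount b D x + bitCount (b + 1) D x = D.card := by
  have := Finset.card_filter_add_card_filter_not (s := D) (fun a => x a = b)
  rw [← this, bitCount, bitCount]
  congr 2
  refine Finset.filter_congr fun c _ => ?_
  generalize x c = s
  fin_cases s <;> fin_cases b <;> simp

lemma magnetization_eq (D : Finset Λ) (x : Λ → Fin 2) :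
    magnetization D x = (bitCount 0 D x : ℝ) - bitCount 1 D x := by
  have h1 : ∀ a, (if x a = 0 then (1 : ℝ) else -1) =
      (if x a = 0 then 1 else 0) - if x a = 1 then 1 else 0 := by
    intro a
    generalize x a = s
    fin_cases s <;> simp
  simp only [magnetization, h1, Finset.sum_sub_distrib, bitCount, Finset.card_filter]
  push_cast
  rfl

open Classical in
/-- The bit strings satisfying `S` with exactly `c` bits `b` in `D`. -/
def layer (S : (Λ → Fin 2) → Prop) (D : Finset Λ) (b : Fin 2) (c : ℕ) : Finset (Λ → Fin 2) :=
  Finset.univ.filter fun x => S x ∧ bitCount b D x = c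

lemma mem_layer {S : (Λ → Fin 2) → Prop} {D : Finset Λ} {b : Fin 2} {c : ℕ} {x : Λ → Fin 2} :
    x ∈ layer S D b c ↔ S x ∧ bitCount b D x = c := by simp [layer]

/-- Above half filling, the layers decrease in size. -/
lemma card_layer_succ_le {S : (Λ → Fin 2) → Prop} {D : Finset Λ}
    (hS : ∀ a ∈ D, ∀ x, S x → S (flip a x)) {h : ℕ} (hD : D.card = 2 * h) (b : Fin 2) {c : ℕ}
    (hc : h ≤ c) : (layer S D b (c + 1)).card ≤ (layer S D b c).card := by
  classical
  have key := Finset.card_mul_le_card_mul (s := layer S D b (c + 1)) (t := layer S D b c)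
    -- Double counting of single flips: a string of the upper layer has `c + 1` neighbours below,
    -- one of the lower layer `2 * h - c` above, and `2 * h - c ≤ c + 1` from half filling on.
    (m := c + 1) (n := 2 * h - c) (fun x y => ∃ a ∈ D, y = flip a x) ?_ ?_
  · have h2 : (layer S D b c).card * (2 * h - c) ≤ (layer S D b c).card * (c + 1) :=
      Nat.mul_le_mul_left _ (by omega)
    exact Nat.le_of_mul_le_mul_right (key.trans h2) (by omega)
  · intro x hx
    rw [mem_layer] at hx
    have hcard : ((D.filter fun a => x a = b).image fun a => flip a x).card = c + 1 := by
      rw [Finset.card_image_of_injective _ (flip_injective x), ← hx.2, bitCount]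
    rw [← hcard]
    refine Finset.card_le_card fun y hy => ?_
    rw [Finset.mem_image] at hy
    obtain ⟨a, ha, rfl⟩ := hy
    rw [Finset.mem_filter] at ha
    rw [Finset.mem_bipartiteAbove, mem_layer]
    refine ⟨⟨hS a ha.1 x hx.1, ?_⟩, a, ha.1, rfl⟩
    have := bitCount_flip ha.1 b x
    simp only [ha.2, if_true] at this
    omega
  · intro y hy
    rw [mem_layer] at hy
    have hcard : ((D.filter fun a => ¬ y a = b).image fun a => flip a y).card = 2 * h - c := by
      rw [Finset.card_image_of_injective _ (flip_injective y)]
      have := Finset.card_filter_add_card_filter_not (s := D) (fun a => y a = b)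
      rw [hD] at this
      have h2 := hy.2
      rw [bitCount] at h2
      omega
    rw [← hcard]
    refine Finset.card_le_card fun x hx => ?_
    rw [Finset.mem_bipartiteBelow, mem_layer] at hx
    obtain ⟨hx, a, ha, rfl⟩ := hx
    rw [Finset.mem_image]
    refine ⟨a, ?_, flip_flip a x⟩
    rw [Finset.mem_filter]
    refine ⟨ha, fun hb => ?_⟩
    have h1 := bitCount_flip ha b x
    have h3 : ¬ x a = b := by
      intro h4
      rw [← h4] at hb
      simp only [flip, Function.update_self] at hb
      generalize x a = s at hb
      fin_cases s <;> simp at hb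
    simp only [h3, if_false] at h1
    omega

end Counting

/-! ### The squeezed state: uniform superposition over a window -/

section Window

/-- In the cluster `D` of `2 * h` qubits, neither bit occurs more than `h + W` times. -/
def InWindow (h W : ℕ) (D : Finset Λ) (x : Λ → Fin 2) : Prop := ∀ b, bitCount b D x ≤ h + W

open Classical in
/-- The set of bit strings satisfying `S`. -/
def strings (S : (Λ → Fin 2) → Prop) : Finset (Λ → Fin 2) := Finset.univ.filter S

lemma mem_strings {S : (Λ → Fin 2) → Prop} {x : Λ → Fin 2} : x ∈ strings S ↔ S x := by
  simp [strings]

open Classical in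
/-- The (unnormalized) uniform superposition of the bit strings satisfying `S`. -/
def uniformState (S : (Λ → Fin 2) → Prop) : EuclideanSpace ℂ (Λ → Fin 2) :=
  WithLp.toLp 2 fun x => if S x then 1 else 0

open Classical in
lemma uniformState_apply (S : (Λ → Fin 2) → Prop) (x : Λ → Fin 2) :
    uniformState S x = if S x then 1 else 0 := rfl

lemma norm_sq_uniformState (S : (Λ → Fin 2) → Prop) :
    ‖uniformState S‖ ^ 2 = ((strings S).card : ℝ) := by
  rw [strings, EuclideanSpace.norm_sq_eq, Finset.card_filter]
  push_cast
  refine Finset.sum_congr rfl fun x _ => ?_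
  rw [uniformState_apply]
  split_ifs <;> simp

variable {S : (Λ → Fin 2) → Prop} {D : Finset Λ} {h W : ℕ}

lemma norm_spinZ_uniformState_le (hD : D.card = 2 * h) :
    ‖act (spin 3 D) (uniformState fun x => S x ∧ InWindow h W D x)‖ ≤
      2 * W * ‖uniformState fun x => S x ∧ InWindow h W D x‖ := by
  refine norm_le_of_norm_apply_le (by positivity) fun x => ?_
  rw [spin_three_eq_diagonal, act_diagonal_apply, norm_mul]
  rw [uniformState_apply]
  split_ifs with hx
  · refine mul_le_mul_of_nonneg_right ?_ (norm_nonneg _)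
    rw [Complex.norm_real, magnetization_eq, Real.norm_eq_abs, abs_le]
    have h0 := hx.2 0
    have h1 := hx.2 1
    have h2 := bitCount_add 0 D x
    rw [zero_add, hD] at h2
    have h0' : (bitCount 0 D x : ℝ) ≤ h + W := by exact_mod_cast h0
    have h1' : (bitCount 1 D x : ℝ) ≤ h + W := by exact_mod_cast h1
    have h2' : (bitCount 0 D x : ℝ) + bitCount 1 D x = 2 * h := by exact_mod_cast h2
    constructor <;> linarith
  · simp

/-- The layers on which the uniform superposition of the window fails to be an eigenstate of the
collective `X` operator carry a small part of the weight. -/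
lemma card_boundary_le (hS : ∀ a ∈ D, ∀ x, S x → S (flip a x)) (hD : D.card = 2 * h) :
    (W + 1) * (strings fun x => S x ∧
        ∃ b, bitCount b D x = h + W ∨ bitCount b D x = h + W + 1).card ≤
      4 * (strings fun x => S x ∧ InWindow h W D x).card := by
  classical
  have hanti : ∀ b, ∀ w ≤ W, (layer S D b (h + W)).card ≤ (layer S D b (h + w)).card := by
    intro b w hw
    obtain ⟨k, rfl⟩ := Nat.exists_eq_add_of_le hw
    clear hw
    induction k with
    | zero => rfl
    | succ k ih => exact (card_layer_succ_le hS hD b (c := h + (w + k)) (by omega)).trans ih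
  -- The `W + 1` disjoint layers from `h` to `h + W` all lie in the window, and the outermost is the
  -- smallest.
  have hlayers : ∀ b, (W + 1) * (layer S D b (h + W)).card ≤
      (strings fun x => S x ∧ InWindow h W D x).card := by
    intro b
    calc (W + 1) * (layer S D b (h + W)).card
        = ∑ w ∈ Finset.range (W + 1), (layer S D b (h + W)).card := by simp
      _ ≤ ∑ w ∈ Finset.range (W + 1), (layer S D b (h + w)).card :=
          Finset.sum_le_sum fun w hw => hanti b w (by simpa [Nat.lt_succ_iff] using hw)
      _ = ((Finset.range (W + 1)).biUnion fun w => layer S D b (h + w)).card := by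
          rw [Finset.card_biUnion]
          intro w _ w' _ hww
          rw [Function.onFun, Finset.disjoint_left]
          intro x hx hx'
          rw [mem_layer] at hx hx'
          omega
      _ ≤ _ := by
          refine Finset.card_le_card fun x hx => ?_
          rw [Finset.mem_biUnion] at hx
          obtain ⟨w, hw, hx⟩ := hx
          rw [mem_layer] at hx
          rw [Finset.mem_range] at hw
          rw [mem_strings]
          refine ⟨hx.1, fun b' => ?_⟩
          by_cases hb : b' = b
          · rw [hb]; omega
          · have : b' = b + 1 := by
              clear hx
              fin_cases b <;> fin_cases b' <;> simp at hb ⊢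
            have h2 := bitCount_add b D x
            rw [← this, hD] at h2
            omega
  have hcover : (strings fun x => S x ∧
        ∃ b, bitCount b D x = h + W ∨ bitCount b D x = h + W + 1) ⊆
      (Finset.univ : Finset (Fin 2)).biUnion fun b =>
        layer S D b (h + W) ∪ layer S D b (h + W + 1) := by
    intro x hx
    rw [mem_strings] at hx
    obtain ⟨hx, b, hb⟩ := hx
    rw [Finset.mem_biUnion]
    refine ⟨b, Finset.mem_univ _, ?_⟩
    rw [Finset.mem_union, mem_layer, mem_layer]
    tauto
  have hcard := (Finset.card_le_card hcover).trans Finset.card_biUnion_le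
  -- The factor 4 is two bit values times two layers, the one just outside the window being no
  -- larger than the one just inside.
  have h2 : ∀ b : Fin 2, (layer S D b (h + W) ∪ layer S D b (h + W + 1)).card ≤
      2 * (layer S D b (h + W)).card := fun b => by
    have := Finset.card_union_le (layer S D b (h + W)) (layer S D b (h + W + 1))
    have := card_layer_succ_le hS hD b (by omega : h ≤ h + W)
    omega
  have h3 := hcard.trans (Finset.sum_le_sum fun b _ => h2 b)
  rw [Fin.sum_univ_two] at h3
  have h4 := hlayers 0
  have h5 := hlayers 1
  nlinarith [Nat.mul_le_mul_left (W + 1) h3]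

lemma act_spinX_apply (D : Finset Λ) (ψ : EuclideanSpace ℂ (Λ → Fin 2)) (x : Λ → Fin 2) :
    act (spin 1 D) ψ x = ∑ a ∈ D, ψ (flip a x) := by
  rw [act_apply]
  simp only [spin, Matrix.sum_apply, siteOp_pauliX_apply, Finset.sum_mul]
  rw [Finset.sum_comm]
  refine Finset.sum_congr rfl fun a _ => ?_
  simp

-- The collective X is the adjacency operator of the single flips in `D`, which is regular of degree
-- `2 * h`. A uniform superposition is thus an exact eigenvector away from strings where a flip
-- crosses the edge of the window. Those boundary strings number at most `4 / (W + 1)` times the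
-- size of the window; the square root enters in passing to norms.
open Classical in
lemma norm_spinX_uniformState_sub_le (hS : ∀ a ∈ D, ∀ x, S x → S (flip a x))
    (hD : D.card = 2 * h) :
    ‖act (spin 1 D) (uniformState fun x => S x ∧ InWindow h W D x) -
        ((2 * h : ℝ) : ℂ) • uniformState fun x => S x ∧ InWindow h W D x‖ ≤
      2 * h * (2 / √(W + 1)) * ‖uniformState fun x => S x ∧ InWindow h W D x‖ := by
  set ψ : EuclideanSpace ℂ (Λ → Fin 2) := uniformState fun x => S x ∧ InWindow h W D x with hψ
  have hψx : ∀ x, ψ x = if S x ∧ InWindow h W D x then 1 else 0 := fun x => by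
    rw [hψ, uniformState_apply]
    split_ifs <;> rfl
  set bd : (Λ → Fin 2) → Prop := fun x => S x ∧
        ∃ b, bitCount b D x = h + W ∨ bitCount b D x = h + W + 1 with hbd
  have hS' : ∀ a ∈ D, ∀ x, S (flip a x) ↔ S x := fun a ha x =>
    ⟨fun hx => by simpa [flip_flip] using hS a ha _ hx, hS a ha x⟩
  have h1 : ‖act (spin 1 D) ψ - ((2 * h : ℝ) : ℂ) • ψ‖ ≤ (2 * h : ℝ) * ‖uniformState bd‖ := by
    refine norm_le_of_norm_apply_le (by positivity) fun x => ?_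
    rw [PiLp.sub_apply, act_spinX_apply, PiLp.smul_apply, smul_eq_mul, uniformState_apply bd]
    have hsum : ∑ a ∈ D, ψ (flip a x) - ((2 * h : ℝ) : ℂ) * ψ x =
        ∑ a ∈ D, (ψ (flip a x) - ψ x) := by
      rw [Finset.sum_sub_distrib, Finset.sum_const, hD]
      simp
    rw [hsum]
    have hterm : ∀ a ∈ D, ‖ψ (flip a x) - ψ x‖ ≤ ‖(if bd x then 1 else 0 : ℂ)‖ := by
      intro a ha
      rw [hψx, hψx, hS' a ha]
      by_cases hb : bd x
      · rw [if_pos hb]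
        split_ifs <;> simp
      · rw [if_neg hb]
        by_cases hSx : S x
        · have hb' : ∀ b, bitCount b D x ≠ h + W ∧ bitCount b D x ≠ h + W + 1 := by
            simpa [hbd, hSx] using hb
          have hwin : InWindow h W D (flip a x) ↔ InWindow h W D x := by
            refine forall_congr' fun b => ?_
            have h2 := hb' b
            have h3 := bitCount_flip ha b x
            split_ifs at h3 <;> omega
          simp [hwin]
        · simp [hSx]
    refine (norm_sum_le _ _).trans ((Finset.sum_le_sum hterm).trans ?_)
    rw [Finset.sum_const, hD]
    split_ifs <;> simp
  have h2 : ‖uniformState bd‖ ≤ 2 / √(W + 1) * ‖ψ‖ := by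
    have h3 : ((W : ℝ) + 1) * ‖uniformState bd‖ ^ 2 ≤ 4 * ‖ψ‖ ^ 2 := by
      rw [hψ, norm_sq_uniformState, norm_sq_uniformState]
      have h4 := card_boundary_le (W := W) hS hD
      have h5 := (Nat.cast_le (α := ℝ)).mpr h4
      push_cast at h5
      exact h5
    refine abs_le_of_sq_le_sq' ?_ (by positivity) |>.2
    rw [mul_pow, div_pow, Real.sq_sqrt (by positivity), div_mul_eq_mul_div,
      le_div_iff₀ (by positivity)]
    linarith
  calc _ ≤ _ := h1
    _ ≤ (2 * h : ℝ) * (2 / √(W + 1) * ‖ψ‖) := by gcongr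
    _ = _ := by ring

end Window

/-! ### The effect of one gate -/

section Gates

/-- The unitary `exp (i θ Σ Z_a Y_b)`, the sum running over `a ∈ D` and `b ∈ E`. -/
def gate (θ : ℝ) (D E : Finset Λ) : QubitOp Λ :=
  NormedSpace.exp ((Complex.I * θ) • (spin 3 D * spin 2 E))

lemma gate_mem_unitary (θ : ℝ) {D E : Finset Λ} (h : Disjoint D E) :
    gate θ D E ∈ unitary (QubitOp Λ) := by
  let +nondep : NormedAlgebra ℚ (QubitOp Λ) := .restrictScalars ℚ ℂ (QubitOp Λ)
  refine NormedSpace.exp_mem_unitary_of_mem_skewAdjoint ?_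
  rw [skewAdjoint.mem_iff, star_smul, Matrix.star_eq_conjTranspose, Matrix.conjTranspose_mul,
    conjTranspose_spin, conjTranspose_spin, (spin_commute h 3 2).eq]
  simp

lemma spin_commute_gate (θ : ℝ) {D E F : Finset Λ} (hD : Disjoint F D) (hE : Disjoint F E)
    (p : Fin 4) : Commute (spin p F) (gate θ D E) :=
  (((spin_commute hD p 3).mul_right (spin_commute hE p 2)).smul_right _).exp_right

/-- The collective Y of `E` generates rotations in the Z–X plane, and the commuting collective Z of
`D` plays the role of an angle. -/
lemma spin_mul_gate (θ : ℝ) {D E : Finset Λ} (h : Disjoint D E) :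
    let c := diagFun (fun s => Real.cos (2 * θ * s)) (magnetization D)
    let s := diagFun (fun s => Real.sin (2 * θ * s)) (magnetization D)
    spin 3 E * gate θ D E = gate θ D E * (c * spin 3 E + s * spin 1 E) ∧
      spin 1 E * gate θ D E = gate θ D E * (c * spin 1 E - s * spin 3 E) := by
  have hI : Complex.I * Complex.I = -1 := Complex.I_mul_I
  have h1 := spin_mul_sub (Λ := Λ) 2 3 1 (2 * Complex.I) (by
    ext a b; fin_cases a <;> fin_cases b <;> simp [pauli, Matrix.mul_apply] <;> ring) E
  have h2 := spin_mul_sub (Λ := Λ) 2 1 3 (-2 * Complex.I) (by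
    ext a b; fin_cases a <;> fin_cases b <;> simp [pauli, Matrix.mul_apply] <;> ring) E
  have hc : ∀ p, Commute (Matrix.diagonal fun x => (magnetization D x : ℂ)) (spin p E) := by
    intro p
    rw [← spin_three_eq_diagonal]
    exact spin_commute h 3 p
  have := rotation θ (hc 2) (hc 3) (hc 1) h1 h2
  rw [← spin_three_eq_diagonal] at this
  exact this

lemma abs_sin_sub_le (θ s μ : ℝ) :
    |Real.sin (2 * θ * s) - Real.sin (2 * θ * μ)| ≤ 2 * |θ| * |s - μ| := by
  refine (Real.abs_sin_sub_sin_le _ _).trans (le_of_eq ?_)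
  rw [← mul_sub, abs_mul, abs_mul, abs_two]

lemma abs_cos_sub_le (θ s μ : ℝ) :
    |Real.cos (2 * θ * s) - Real.cos (2 * θ * μ)| ≤ 2 * |θ| * |s - μ| := by
  refine (Real.abs_cos_sub_cos_le _ _).trans (le_of_eq ?_)
  rw [← mul_sub, abs_mul, abs_mul, abs_two]

variable {D E : Finset Λ} {φ : EuclideanSpace ℂ (Λ → Fin 2)} {μ e p q : ℝ}

/-- A state in which the magnetization of `D` is close to `μ`, and in which the collective spin of
`E` is squeezed and polarized in the `X` direction, is mapped by the gate to a state in which the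
magnetization of `E` is close to `|E| sin (2 θ μ)`. -/
lemma norm_spinZ_gate_sub_le (θ : ℝ) (h : Disjoint D E)
    (hD : ‖act (spin 3 D) φ - (μ : ℂ) • φ‖ ≤ e) (hZ : ‖act (spin 3 E) φ‖ ≤ p)
    (hX : ‖act (spin 1 E) φ - ((E.card : ℝ) : ℂ) • φ‖ ≤ q) :
    ‖act (spin 3 E) (act (gate θ D E) φ) -
        ((E.card * Real.sin (2 * θ * μ) : ℝ) : ℂ) • act (gate θ D E) φ‖ ≤
      p + |Real.sin (2 * θ * μ)| * q + 2 * E.card * |θ| * e := by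
  set V := gate θ D E with hV
  set c : QubitOp Λ := diagFun (fun s => Real.cos (2 * θ * s)) (magnetization D) with hc
  set s : QubitOp Λ := diagFun (fun s => Real.sin (2 * θ * s)) (magnetization D) with hs
  set σ := Real.sin (2 * θ * μ) with hσ
  -- Moving the sine to the right of the collective X lets it act on `φ` itself, where the
  -- magnetization of `D` is known to be concentrated.
  have hcomm : Commute s (spin 1 E) := by
    refine diagFun_commute ?_ _
    rw [← spin_three_eq_diagonal]
    exact spin_commute h 3 1
  -- Three errors: the initial Z-spin of `E`, the fluctuation of the control `D` seen through the
  -- sine, and the imperfect X-polarization of `E`.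
  have e1 : act (spin 3 E) (act V φ) - ((E.card * σ : ℝ) : ℂ) • act V φ =
      act V (act c (act (spin 3 E) φ) + act (spin 1 E) (act s φ - (σ : ℂ) • φ) +
        (σ : ℂ) • (act (spin 1 E) φ - ((E.card : ℝ) : ℂ) • φ)) := by
    have hg : spin 3 E * V = V * (c * spin 3 E + s * spin 1 E) := (spin_mul_gate θ h).1
    have hsX : act s (act (spin 1 E) φ) = act (spin 1 E) (act s φ) := by
      rw [← act_mul, hcomm.eq, act_mul]
    rw [← act_mul, hg, act_mul, act_add, act_mul c, act_mul s, hsX, act_vec_sub (spin 1 E),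
      act_vec_smul (spin 1 E), ← act_vec_smul V, ← act_vec_sub V, Complex.ofReal_mul]
    congr 1
    module
  have hs' : ‖act s φ - (σ : ℂ) • φ‖ ≤ 2 * |θ| * e := by
    refine (norm_diagFun_sub_le (by positivity) _ μ (fun t => abs_sin_sub_le θ t μ) φ).trans ?_
    rw [← spin_three_eq_diagonal]
    gcongr
  rw [e1, norm_act_of_mem_unitary (gate_mem_unitary θ h)]
  refine (norm_add₃_le).trans ?_
  have t1 : ‖act c (act (spin 3 E) φ)‖ ≤ p := by
    refine (norm_act_le _ _).trans ?_
    have := norm_diagFun_le (f := fun s => Real.cos (2 * θ * s))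
      (fun s => Real.abs_cos_le_one _) (magnetization D)
    calc ‖c‖ * ‖act (spin 3 E) φ‖ ≤ 1 * ‖act (spin 3 E) φ‖ := by gcongr
      _ ≤ p := by rwa [one_mul]
  have t2 : ‖act (spin 1 E) (act s φ - (σ : ℂ) • φ)‖ ≤ E.card * (2 * |θ| * e) := by
    refine (norm_act_le _ _).trans ?_
    have := norm_spin_le 1 E
    gcongr
  have t3 : ‖(σ : ℂ) • (act (spin 1 E) φ - ((E.card : ℝ) : ℂ) • φ)‖ ≤ |σ| * q := by
    rw [norm_smul, Complex.norm_real, Real.norm_eq_abs]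
    gcongr
  linarith

/-- If `2 θ μ = ± π / 2`, then a qubit in the state `0` is rotated to the eigenstate `∓ 1` of
its Pauli matrix `X`. -/
lemma norm_pauliX_gate_add_le (θ : ℝ) {i : Λ} (h : Disjoint D {i})
    (hD : ‖act (spin 3 D) φ - (μ : ℂ) • φ‖ ≤ e) (hZ : act (spin 3 {i}) φ = φ)
    (hcos : Real.cos (2 * θ * μ) = 0) :
    ‖act (pauliX i) (act (gate θ D {i}) φ) +
        ((Real.sin (2 * θ * μ) : ℝ) : ℂ) • act (gate θ D {i}) φ‖ ≤ 4 * |θ| * e := by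
  set V := gate θ D {i} with hV
  set c : QubitOp Λ := diagFun (fun s => Real.cos (2 * θ * s)) (magnetization D) with hc
  set s : QubitOp Λ := diagFun (fun s => Real.sin (2 * θ * s)) (magnetization D) with hs
  set σ := Real.sin (2 * θ * μ) with hσ
  have hcomm : Commute c (spin 1 {i}) := by
    refine diagFun_commute ?_ _
    rw [← spin_three_eq_diagonal]
    exact spin_commute h 3 1
  have hXi : (pauliX i : QubitOp Λ) = spin 1 {i} := by
    rw [spin_singleton, pauliX, pauliString_single]
  have e1 : act (pauliX i) (act V φ) + (σ : ℂ) • act V φ =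
      act V (act (spin 1 {i}) (act c φ) - (act s φ - (σ : ℂ) • φ)) := by
    have hg : spin 1 {i} * V = V * (c * spin 1 {i} - s * spin 3 {i}) := (spin_mul_gate θ h).2
    rw [hXi, ← act_mul, hg, act_mul, act_sub, act_mul s, hZ, hcomm.eq, act_mul (spin 1 {i}),
      act_vec_sub V, act_vec_sub V, act_vec_sub V, act_vec_smul V]
    module
  have hs' : ‖act s φ - (σ : ℂ) • φ‖ ≤ 2 * |θ| * e := by
    refine (norm_diagFun_sub_le (by positivity) _ μ (fun t => abs_sin_sub_le θ t μ) φ).trans ?_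
    rw [← spin_three_eq_diagonal]
    gcongr
  have hc' : ‖act c φ‖ ≤ 2 * |θ| * e := by
    have := norm_diagFun_sub_le (f := fun s => Real.cos (2 * θ * s)) (by positivity)
      (magnetization D) μ (fun t => abs_cos_sub_le θ t μ) φ
    simp only [hcos, Complex.ofReal_zero, zero_smul, sub_zero] at this
    refine this.trans ?_
    rw [← spin_three_eq_diagonal]
    gcongr
  rw [e1, norm_act_of_mem_unitary (gate_mem_unitary θ h)]
  refine (norm_sub_le _ _).trans ?_
  have t2 : ‖act (spin 1 {i}) (act c φ)‖ ≤ 1 * ‖act c φ‖ := by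
    refine (norm_act_le _ _).trans ?_
    have := norm_spin_le (Λ := Λ) 1 {i}
    simp only [Finset.card_singleton, Nat.cast_one] at this
    gcongr
  linarith

end Gates

/-! ### Propagation of the signal along a chain -/

section Chain

/-- The propagator of the first `k` gates along a chain of clusters. -/
def chainOp (θ : ℕ → ℝ) (C : ℕ → Finset Λ) : ℕ → QubitOp Λ
  | 0 => 1
  | k + 1 => gate (θ k) (C k) (C (k + 1)) * chainOp θ C k

variable {θ : ℕ → ℝ} {C : ℕ → Finset Λ} {m : ℕ}

lemma chainOp_mem_unitary (hC : ∀ k ≤ m, ∀ l ≤ m, k ≠ l → Disjoint (C k) (C l)) :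
    ∀ k ≤ m, chainOp θ C k ∈ unitary (QubitOp Λ)
  | 0, _ => one_mem _
  | k + 1, hk => mul_mem (gate_mem_unitary _ (hC k (by omega) _ hk (by omega)))
      (chainOp_mem_unitary hC k (by omega))

lemma spin_commute_chainOp (hC : ∀ k ≤ m, ∀ l ≤ m, k ≠ l → Disjoint (C k) (C l)) (p : Fin 4)
    {l : ℕ} (hl : l ≤ m) : ∀ k < l, Commute (spin p (C l)) (chainOp θ C k)
  | 0, _ => Commute.one_right _
  | k + 1, hk => (spin_commute_gate _ (hC l hl k (by omega) (by omega))
      (hC l hl (k + 1) (by omega) (by omega)) p).mul_right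
      (spin_commute_chainOp hC p hl k (by omega))

/-- The first `k` gates do not touch cluster `k + 1`, so it still has its initial squeezing and
polarization when gate `k` acts on it. The sequence `e` records the accumulated fluctuation. -/
lemma norm_act_chainOp_sub_le (hC : ∀ k ≤ m + 1, ∀ l ≤ m + 1, k ≠ l → Disjoint (C k) (C l))
    {ψ : EuclideanSpace ℂ (Λ → Fin 2)} {μ e : ℕ → ℝ} {n p q : ℝ}
    (hn : ∀ k, 1 ≤ k → k ≤ m → ((C k).card : ℝ) = n)
    (h0 : act (spin 3 (C 0)) ψ = (μ 0 : ℂ) • ψ)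
    (hZ : ∀ k, 1 ≤ k → k ≤ m → ‖act (spin 3 (C k)) ψ‖ ≤ p)
    (hX : ∀ k, 1 ≤ k → k ≤ m → ‖act (spin 1 (C k)) ψ - (n : ℂ) • ψ‖ ≤ q)
    (hμ : ∀ k < m, μ (k + 1) = n * Real.sin (2 * θ k * μ k)) (he0 : 0 ≤ e 0)
    (he : ∀ k < m, p + |Real.sin (2 * θ k * μ k)| * q + 2 * n * |θ k| * e k ≤ e (k + 1)) :
    ∀ k ≤ m, ‖act (spin 3 (C k)) (act (chainOp θ C k) ψ) - (μ k : ℂ) • act (chainOp θ C k) ψ‖ ≤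
      e k := by
  intro k
  induction k with
  | zero =>
    intro _
    simpa [chainOp, act_one, h0] using he0
  | succ k ih =>
    intro hk
    have hW : chainOp θ C k ∈ unitary (QubitOp Λ) := chainOp_mem_unitary hC k (by omega)
    have hcomm : ∀ r, Commute (spin r (C (k + 1))) (chainOp θ C k) := fun r =>
      spin_commute_chainOp hC r (by omega) k (by omega)
    have hcard := hn (k + 1) (by omega) hk
    have key := norm_spinZ_gate_sub_le (θ k) (φ := act (chainOp θ C k) ψ)
      (hC k (by omega) (k + 1) (by omega) (by omega)) (ih (by omega)) (p := p) (q := q) ?_ ?_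
    · rw [hcard, ← hμ k (by omega)] at key
      rw [chainOp, act_mul]
      exact key.trans (he k (by omega))
    · rw [← act_mul, (hcomm 3).eq, act_mul, norm_act_of_mem_unitary hW]
      exact hZ _ (by omega) hk
    · rw [hcard, ← act_mul, (hcomm 1).eq, act_mul, ← act_vec_smul, ← act_vec_sub,
        norm_act_of_mem_unitary hW]
      exact hX _ (by omega) hk

lemma pauliX_mem_unitary (j : Λ) : (pauliX j : QubitOp Λ) ∈ unitary (QubitOp Λ) := by
  rw [Unitary.mem_iff, pauliX, Matrix.star_eq_conjTranspose, conjTranspose_pauliString]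
  exact ⟨pauliString_mul_self _, pauliString_mul_self _⟩

/-- If `ψ` and `X_j ψ` are close to eigenstates of `U† X_i U` with eigenvalues `-1` and `1`, then
the commutator of `U† X_i U` and `X_j` has norm at least `1`. -/
lemma one_le_norm_commutator {U : QubitOp Λ} (hU : U ∈ unitary (QubitOp Λ)) {i j : Λ}
    {ψ : EuclideanSpace ℂ (Λ → Fin 2)} (hψ : ‖ψ‖ = 1) {η : ℝ} (hη : η ≤ 1 / 2)
    (h₁ : ‖act (pauliX i) (act U ψ) + act U ψ‖ ≤ η)
    (h₂ : ‖act (pauliX i) (act U (act (pauliX j) ψ)) - act U (act (pauliX j) ψ)‖ ≤ η) :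
    1 ≤ ‖(Uᴴ * pauliX i * U) * pauliX j - pauliX j * (Uᴴ * pauliX i * U)‖ := by
  set X := pauliX j with hXj
  have hX : X ∈ unitary (QubitOp Λ) := pauliX_mem_unitary j
  have hUU : Uᴴ * U = 1 := (Unitary.mem_iff.mp hU).1
  have hU' : Uᴴ ∈ unitary (QubitOp Λ) := Unitary.star_mem hU
  -- With exact eigenvectors the commutator would send `ψ` to `2 X ψ`; the remainder consists of the
  -- two defects.
  have e1 : act ((Uᴴ * pauliX i * U) * X - X * (Uᴴ * pauliX i * U)) ψ =
      (2 : ℂ) • act X ψ + (act Uᴴ (act (pauliX i) (act U (act X ψ)) - act U (act X ψ)) -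
        act X (act Uᴴ (act (pauliX i) (act U ψ) + act U ψ))) := by
    have hadd : ∀ (M : QubitOp Λ) (φ χ : EuclideanSpace ℂ (Λ → Fin 2)),
        act M (φ + χ) = act M φ + act M χ := fun M φ χ => by simp [act]
    simp only [act_sub, act_mul, act_vec_sub, hadd]
    rw [← act_mul Uᴴ U, hUU, act_one, ← act_mul Uᴴ U, hUU, act_one]
    module
  have h3 : ‖act ((Uᴴ * pauliX i * U) * X - X * (Uᴴ * pauliX i * U)) ψ‖ ≥ 2 - (η + η) := by
    rw [e1]
    have a1 : ‖(2 : ℂ) • act X ψ‖ = 2 := by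
      rw [norm_smul, norm_act_of_mem_unitary hX, hψ]; simp
    have a2 : ‖act Uᴴ (act (pauliX i) (act U (act X ψ)) - act U (act X ψ)) -
        act X (act Uᴴ (act (pauliX i) (act U ψ) + act U ψ))‖ ≤ η + η := by
      refine (norm_sub_le _ _).trans ?_
      rw [norm_act_of_mem_unitary hU', norm_act_of_mem_unitary hX, norm_act_of_mem_unitary hU']
      exact add_le_add h₂ h₁
    have := norm_sub_le_norm_add ((2 : ℂ) • act X ψ)
      (act Uᴴ (act (pauliX i) (act U (act X ψ)) - act U (act X ψ)) -
        act X (act Uᴴ (act (pauliX i) (act U ψ) + act U ψ)))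
    linarith
  have h4 := norm_act_le ((Uᴴ * pauliX i * U) * X - X * (Uᴴ * pauliX i * U)) ψ
  rw [hψ, mul_one] at h4
  linarith

end Chain

/-! ### Choice of angles and control of errors -/

section Schedule

lemma half_le_sin {y : ℝ} (h0 : 0 ≤ y) (h1 : y ≤ 1) : y / 2 ≤ Real.sin y := by
  refine le_trans ?_ (Real.mul_le_sin h0 (by linarith [Real.pi_gt_three]))
  rw [div_eq_inv_mul]
  refine mul_le_mul_of_nonneg_right ?_ h0
  rw [inv_eq_one_div, div_le_div_iff₀ (by norm_num) Real.pi_pos]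
  linarith [Real.pi_le_four]

/-- The iteration of mean magnetizations `μ ↦ n sin (x μ / n)`. -/
def meanMag (n x : ℝ) : ℕ → ℝ
  | 0 => 1
  | k + 1 => n * Real.sin (x * meanMag n x k / n)

/-- The upper bound keeps the argument of the sine at most `x ^ (k + 1) / n ≤ 1`, and there the sine
lies between half its argument and its argument. -/
lemma meanMag_bounds {n x : ℝ} {m : ℕ} (hx : 2 ≤ x) (hn : x ^ (m + 1) = n) :
    ∀ k ≤ m, (x / 2) ^ k ≤ meanMag n x k ∧ meanMag n x k ≤ x ^ k
  | 0, _ => by simp [meanMag]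
  | k + 1, hk => by
    obtain ⟨h1, h2⟩ := meanMag_bounds hx hn k (by omega)
    have hn0 : 0 < n := by rw [← hn]; positivity
    have hμ : 0 < meanMag n x k := lt_of_lt_of_le (by positivity) h1
    have hy0 : 0 ≤ x * meanMag n x k / n := by positivity
    have hy1 : x * meanMag n x k / n ≤ 1 := by
      refine (div_le_one hn0).mpr ?_
      calc x * meanMag n x k ≤ x * x ^ k := by gcongr
        _ = x ^ (k + 1) := by ring
        _ ≤ x ^ (m + 1) := pow_le_pow_right₀ (by linarith) (by omega)
        _ = n := hn
    have hs := half_le_sin hy0 hy1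
    constructor
    · calc (x / 2) ^ (k + 1) = x / 2 * (x / 2) ^ k := by ring
        _ ≤ x / 2 * meanMag n x k := by gcongr
        _ = n * (x * meanMag n x k / n / 2) := by field_simp
        _ ≤ n * Real.sin (x * meanMag n x k / n) := by gcongr
        _ = _ := rfl
    · calc meanMag n x (k + 1) = n * Real.sin (x * meanMag n x k / n) := rfl
        _ ≤ n * (x * meanMag n x k / n) := by gcongr; exact Real.sin_le hy0
        _ = x * meanMag n x k := by field_simp
        _ ≤ x * x ^ k := by gcongr
        _ = x ^ (k + 1) := by ring

/-- Gate angles, mean magnetizations and fluctuations along the chain. -/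
lemma exists_schedule {n x a ε : ℝ} {m : ℕ} (hx : 2 ≤ x) (hn : x ^ (m + 1) = n) (ha : 0 ≤ a)
    (hε : 0 ≤ ε) (hκ : (2 * a / x + ε) * 2 ^ m ≤ 1 / 8) :
    ∃ θ μ e : ℕ → ℝ, μ 0 = 1 ∧ (∀ k, 0 ≤ θ k ∧ θ k ≤ 2 ^ m * x / n) ∧
      (∀ k < m, μ (k + 1) = n * Real.sin (2 * θ k * μ k)) ∧ 0 ≤ e 0 ∧
      (∀ k < m, a + |Real.sin (2 * θ k * μ k)| * (n * ε) + 2 * n * |θ k| * e k ≤ e (k + 1)) ∧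
      2 * θ m * μ m = Real.pi / 2 ∧ 4 * |θ m| * e m ≤ 1 / 2 := by
  have hx0 : 0 < x := by linarith
  have hn0 : 0 < n := by rw [← hn]; positivity
  set μ := meanMag n x with hμ
  have hb := meanMag_bounds hx hn
  have hμ0 : ∀ k ≤ m, 0 < μ k := fun k hk => lt_of_lt_of_le (by positivity) (hb k hk).1
  set κ := 2 * a / x + ε with hκdef
  have hκ0 : 0 ≤ κ := by positivity
  have hm := hμ0 m le_rfl
  -- The first `m` angles amplify by about `x`; the last makes the rotation a quarter turn. The
  -- relative error `κ (2 ^ k - 1)` solves the recursion "double, then add `κ`": doubling comes from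
  -- `x μ k ≤ 2 μ (k + 1)`, and `κ` collects the absolute noise `a`, relative to `μ (k + 1) ≥ x /
  -- 2`, and the polarization defect `ε`.
  refine ⟨fun k => if k < m then x / (2 * n) else Real.pi / (4 * μ m), μ,
    fun k => κ * (2 ^ k - 1) * μ k, rfl, ?_, ?_, by simp, ?_, ?_, ?_⟩
  · intro k
    dsimp only
    split_ifs with hk
    · refine ⟨by positivity, ?_⟩
      rw [div_le_div_iff₀ (by positivity) hn0]
      have : (1 : ℝ) ≤ 2 ^ m := one_le_pow₀ (by norm_num)
      nlinarith [mul_pos hx0 hn0]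
    · refine ⟨by positivity, ?_⟩
      have h1 := (hb m le_rfl).1
      rw [div_le_div_iff₀ (by positivity) hn0]
      have h2 : 2 ^ m * x * (x / 2) ^ m = n := by
        rw [div_pow, ← hn, pow_succ]; field_simp
      have h3 : 2 ^ m * x * (4 * (x / 2) ^ m) ≤ 2 ^ m * x * (4 * μ m) := by gcongr
      nlinarith [Real.pi_le_four]
  · intro k hk
    simp only [if_pos hk]
    rw [hμ, meanMag]
    congr 2
    field_simp
  · intro k hk
    simp only [if_pos hk]
    have hk1 : μ (k + 1) = n * Real.sin (2 * (x / (2 * n)) * μ k) := by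
      rw [hμ, meanMag]
      congr 2
      field_simp
    have hpos := hμ0 (k + 1) (by omega)
    have hsin : 0 < Real.sin (2 * (x / (2 * n)) * μ k) := by
      rw [hk1] at hpos
      exact pos_of_mul_pos_right hpos hn0.le
    rw [abs_of_pos hsin, abs_of_pos (by positivity : 0 < x / (2 * n))]
    have h1 : Real.sin (2 * (x / (2 * n)) * μ k) * (n * ε) = ε * μ (k + 1) := by rw [hk1]; ring
    have h2 : 2 * n * (x / (2 * n)) = x := by field_simp
    rw [h1, h2]
    have h3 : x / 2 ≤ μ (k + 1) := by
      refine le_trans ?_ (hb (k + 1) (by omega)).1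
      exact le_self_pow₀ (by linarith) (by omega)
    have h4 : a ≤ 2 * a / x * μ (k + 1) := by
      calc a = 2 * a / x * (x / 2) := by field_simp
        _ ≤ _ := by gcongr
    have hxm : x * μ k ≤ 2 * μ (k + 1) := by
      have hy0 : 0 ≤ x * μ k / n := by have := hμ0 k (by omega); positivity
      have hy1 : x * μ k / n ≤ 1 := by
        refine (div_le_one hn0).mpr ?_
        calc x * μ k ≤ x * x ^ k := by gcongr; exact (hb k (by omega)).2
          _ = x ^ (k + 1) := by ring
          _ ≤ x ^ (m + 1) := pow_le_pow_right₀ (by linarith) (by omega)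
          _ = n := hn
      have hs := half_le_sin hy0 hy1
      calc x * μ k = 2 * (n * (x * μ k / n / 2)) := by field_simp
        _ ≤ 2 * (n * Real.sin (x * μ k / n)) := by gcongr
        _ = _ := rfl
    have h5 : (0 : ℝ) ≤ 2 ^ k - 1 := by
      have : (1 : ℝ) ≤ 2 ^ k := one_le_pow₀ (by norm_num)
      linarith
    have h6 : x * (κ * (2 ^ k - 1) * μ k) ≤ κ * (2 ^ k - 1) * (2 * μ (k + 1)) := by
      calc x * (κ * (2 ^ k - 1) * μ k) = κ * (2 ^ k - 1) * (x * μ k) := by ring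
        _ ≤ _ := by gcongr
    have h7 : κ * (2 ^ (k + 1) - 1) * μ (k + 1) =
        κ * (2 ^ k - 1) * (2 * μ (k + 1)) + (2 * a / x) * μ (k + 1) + ε * μ (k + 1) := by
      rw [hκdef]; ring
    rw [h7]
    linarith
  · simp only [lt_irrefl, if_false]
    field_simp
    norm_num
  · simp only [lt_irrefl, if_false]
    rw [abs_of_pos (by positivity)]
    have h1 : 4 * (Real.pi / (4 * μ m)) * (κ * (2 ^ m - 1) * μ m) = Real.pi * (κ * (2 ^ m - 1)) := by
      field_simp
    rw [h1]
    have h2 : κ * (2 ^ m - 1) ≤ 1 / 8 := by linarith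
    have h3 : (0 : ℝ) ≤ 2 ^ m - 1 := by
      have : (1 : ℝ) ≤ 2 ^ m := one_le_pow₀ (by norm_num)
      linarith
    calc Real.pi * (κ * (2 ^ m - 1)) ≤ 4 * (1 / 8) := by
          gcongr
          exact Real.pi_le_four
      _ = 1 / 2 := by norm_num

end Schedule

/-! ### The initial state, and signalling through the whole chain -/

section Chain

variable {C : ℕ → Finset Λ} {m : ℕ}

lemma InWindow.flip_of_notMem {h W : ℕ} {D : Finset Λ} {x : Λ → Fin 2} (hx : InWindow h W D x)
    {a : Λ} (ha : a ∉ D) : InWindow h W D (flip a x) := fun b => by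
  rw [bitCount_flip_of_notMem ha]
  exact hx b

/-- Setting exactly half of the bits of each intermediate cluster gives such a string. It ensures
that the superposition below is nonzero and can be normalized. -/
lemma exists_inWindow (hC : ∀ k ≤ m + 1, ∀ l ≤ m + 1, k ≠ l → Disjoint (C k) (C l)) {h W : ℕ}
    (hcard : ∀ k, 1 ≤ k → k ≤ m → (C k).card = 2 * h) :
    ∃ x : Λ → Fin 2, (∀ a ∈ C 0, x a = 0) ∧ (∀ a ∈ C (m + 1), x a = 0) ∧
      ∀ k, 1 ≤ k → k ≤ m → InWindow h W (C k) x := by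
  have hex : ∀ k, ∃ B : Finset Λ, B ⊆ C k ∧ (1 ≤ k → k ≤ m → B.card = h) := by
    intro k
    by_cases hk : 1 ≤ k ∧ k ≤ m
    · obtain ⟨B, hB, hB'⟩ := Finset.exists_subset_card_eq
        (show h ≤ (C k).card by rw [hcard k hk.1 hk.2]; omega)
      exact ⟨B, hB, fun _ _ => hB'⟩
    · exact ⟨∅, by simp, fun h1 h2 => absurd ⟨h1, h2⟩ hk⟩
  choose B hB hBcard using hex
  classical
  refine ⟨fun a => if ∃ k, 1 ≤ k ∧ k ≤ m ∧ a ∈ B k then 1 else 0, ?_, ?_, ?_⟩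
  · intro a ha
    refine if_neg ?_
    rintro ⟨k, hk1, hk2, hak⟩
    exact Finset.disjoint_left.mp (hC 0 (by omega) k (by omega) (by omega)) ha (hB k hak)
  · intro a ha
    refine if_neg ?_
    rintro ⟨k, hk1, hk2, hak⟩
    exact Finset.disjoint_left.mp (hC (m + 1) (by omega) k (by omega) (by omega)) ha (hB k hak)
  · intro k hk1 hk2
    have h1 : bitCount 1 (C k)
        (fun a => if ∃ k, 1 ≤ k ∧ k ≤ m ∧ a ∈ B k then 1 else 0) = h := by
      rw [bitCount, ← hBcard k hk1 hk2]
      congr 1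
      ext a
      simp only [Finset.mem_filter, ite_eq_left_iff, zero_ne_one, imp_false, not_not]
      constructor
      · rintro ⟨ha, l, hl1, hl2, hal⟩
        by_cases hkl : k = l
        · rwa [hkl]
        · exact absurd (hB l hal)
            (Finset.disjoint_left.mp (hC k (by omega) l (by omega) hkl) ha)
      · exact fun ha => ⟨hB k ha, k, hk1, hk2, ha⟩
    have h0 := bitCount_add 0 (C k) (fun a => if ∃ k, 1 ≤ k ∧ k ≤ m ∧ a ∈ B k then 1 else 0)
    rw [zero_add, h1, hcard k hk1 hk2] at h0
    intro b
    have hb : b = 0 ∨ b = 1 := by fin_cases b <;> simp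
    rcases hb with rfl | rfl <;> omega

lemma act_siteOp_pauliZ_uniformState {S : (Λ → Fin 2) → Prop} {a : Λ} (hS : ∀ x, S x → x a = 0) :
    act (spin 3 {a}) (uniformState S) = uniformState S := by
  refine PiLp.ext fun x => ?_
  rw [spin_singleton, siteOp_pauliZ, act_diagonal_apply, uniformState_apply]
  by_cases hx : S x
  · simp [hS x hx]
  · simp [hx]

/-- A state in which the end points of the chain are in the state `0` and every cluster in between
is squeezed in the `Z` direction and polarized in the `X` direction. -/
lemma exists_squeezed_state (hC : ∀ k ≤ m + 1, ∀ l ≤ m + 1, k ≠ l → Disjoint (C k) (C l)) {i j : Λ}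
    (hj : C 0 = {j}) (hi : C (m + 1) = {i}) {h : ℕ} (W : ℕ)
    (hcard : ∀ k, 1 ≤ k → k ≤ m → (C k).card = 2 * h) :
    ∃ ψ : EuclideanSpace ℂ (Λ → Fin 2), ‖ψ‖ = 1 ∧ act (spin 3 {j}) ψ = ψ ∧
      act (spin 3 {i}) ψ = ψ ∧ ∀ k, 1 ≤ k → k ≤ m → ‖act (spin 3 (C k)) ψ‖ ≤ 2 * W ∧
        ‖act (spin 1 (C k)) ψ - ((2 * h : ℝ) : ℂ) • ψ‖ ≤ 2 * h * (2 / √(W + 1)) := by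
  set S : (Λ → Fin 2) → Prop := fun x =>
    x j = 0 ∧ x i = 0 ∧ ∀ k, 1 ≤ k → k ≤ m → InWindow h W (C k) x with hS
  set φ := uniformState S with hφ
  have hφ0 : 0 < ‖φ‖ := by
    obtain ⟨x, hxj, hxi, hx⟩ := exists_inWindow (W := W) hC hcard
    have hxS : S x := ⟨hxj j (by simp [hj]), hxi i (by simp [hi]), hx⟩
    rw [norm_pos_iff]
    intro h0
    have h1 := congrArg (fun v : EuclideanSpace ℂ (Λ → Fin 2) => v x) h0
    simp [hφ, uniformState_apply, hxS] at h1
  have hr : ‖((‖φ‖⁻¹ : ℝ) : ℂ)‖ = ‖φ‖⁻¹ := by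
    rw [Complex.norm_real, Real.norm_eq_abs, abs_of_pos (by positivity)]
  refine ⟨((‖φ‖⁻¹ : ℝ) : ℂ) • φ, ?_, ?_, ?_, ?_⟩
  · rw [norm_smul, hr, inv_mul_cancel₀ hφ0.ne']
  · rw [act_vec_smul, act_siteOp_pauliZ_uniformState fun x hx => hx.1]
  · rw [act_vec_smul, act_siteOp_pauliZ_uniformState fun x hx => hx.2.1]
  · intro k hk1 hk2
    -- All conditions not concerning cluster `k` are split off; they are stable under flips in `C
    -- k`, as the one-cluster estimates require.
    set Sk : (Λ → Fin 2) → Prop := fun x =>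
      x j = 0 ∧ x i = 0 ∧ ∀ l, 1 ≤ l → l ≤ m → l ≠ k → InWindow h W (C l) x with hSk
    have hSSk : φ = uniformState fun x => Sk x ∧ InWindow h W (C k) x := by
      rw [hφ]
      congr 1
      funext x
      refine propext ⟨fun hx => ⟨⟨hx.1, hx.2.1, fun l h1 h2 _ => hx.2.2 l h1 h2⟩,
        hx.2.2 k hk1 hk2⟩, fun hx => ⟨hx.1.1, hx.1.2.1, fun l h1 h2 => ?_⟩⟩
      by_cases hlk : l = k
      · rw [hlk]; exact hx.2
      · exact hx.1.2.2 l h1 h2 hlk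
    have hSkflip : ∀ a ∈ C k, ∀ x, Sk x → Sk (flip a x) := by
      intro a ha x hx
      have hne : ∀ l ≤ m + 1, l ≠ k → a ∉ C l := fun l hl hlk =>
        Finset.disjoint_left.mp (hC k (by omega) l hl hlk.symm) ha
      refine ⟨?_, ?_, fun l h1 h2 h3 => (hx.2.2 l h1 h2 h3).flip_of_notMem (hne l (by omega) h3)⟩
      · have := hne 0 (by omega) (by omega)
        rw [hj, Finset.mem_singleton] at this
        rw [flip_of_ne (Ne.symm this)]
        exact hx.1
      · have := hne (m + 1) (by omega) (by omega)
        rw [hi, Finset.mem_singleton] at this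
        rw [flip_of_ne (Ne.symm this)]
        exact hx.2.1
    have h1 := norm_spinZ_uniformState_le (S := Sk) (W := W) (hcard k hk1 hk2)
    have h2 := norm_spinX_uniformState_sub_le (W := W) hSkflip (hcard k hk1 hk2)
    rw [← hSSk] at h1 h2
    constructor
    · rw [act_vec_smul, norm_smul, hr, inv_mul_le_iff₀ hφ0, mul_comm ‖φ‖]
      exact h1
    · rw [act_vec_smul, smul_comm, ← smul_sub, norm_smul, hr, inv_mul_le_iff₀ hφ0, mul_comm ‖φ‖]
      exact h2

/-- Signalling along a chain of clusters of `n = x ^ (m + 1)` qubits in time `O(x / n)`. -/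
theorem exists_chainOp_commutator
    (hC : ∀ k ≤ m + 1, ∀ l ≤ m + 1, k ≠ l → Disjoint (C k) (C l)) {i j : Λ}
    (hj : C 0 = {j}) (hi : C (m + 1) = {i}) {h W : ℕ}
    (hcard : ∀ k, 1 ≤ k → k ≤ m → (C k).card = 2 * h) {x : ℝ} (hx : 2 ≤ x)
    (hxn : x ^ (m + 1) = 2 * h) (hW : (2 * (2 * W) / x + 2 / √(W + 1)) * 2 ^ m ≤ 1 / 8) :
    ∃ θ : ℕ → ℝ, (∀ k, 0 ≤ θ k ∧ θ k ≤ 2 ^ m * x / (2 * h)) ∧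
      1 ≤ ‖((chainOp θ C (m + 1))ᴴ * pauliX i * chainOp θ C (m + 1)) * pauliX j -
        pauliX j * ((chainOp θ C (m + 1))ᴴ * pauliX i * chainOp θ C (m + 1))‖ := by
  obtain ⟨θ, μ, e, hμ0, hθ, hμ, he0, he, hm1, hm2⟩ :=
    exists_schedule hx hxn (by positivity) (by positivity) hW
  obtain ⟨ψ, hψ, hψj, hψi, hψk⟩ := exists_squeezed_state hC hj hi W hcard
  have hn : ∀ k, 1 ≤ k → k ≤ m → ((C k).card : ℝ) = 2 * h := fun k h1 h2 => by
    rw [hcard k h1 h2]; push_cast; ring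
  have hU : chainOp θ C (m + 1) ∈ unitary (QubitOp Λ) := chainOp_mem_unitary hC _ le_rfl
  have hdisj : Disjoint (C m) {i} := by
    rw [← hi]; exact hC m (by omega) (m + 1) le_rfl (by omega)
  have hcos : Real.cos (2 * θ m * μ m) = 0 := by rw [hm1, Real.cos_pi_div_two]
  have hsin : Real.sin (2 * θ m * μ m) = 1 := by rw [hm1, Real.sin_pi_div_two]
  have hZi : ∀ χ, act (spin 3 {i}) χ = χ →
      act (spin 3 {i}) (act (chainOp θ C m) χ) = act (chainOp θ C m) χ := by
    intro χ hχ
    have := spin_commute_chainOp (θ := θ) hC 3 le_rfl m (by omega)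
    rw [hi] at this
    rw [← act_mul, this.eq, act_mul, hχ]
  refine ⟨θ, hθ, one_le_norm_commutator hU hψ hm2 ?_ ?_⟩
  · have key := norm_act_chainOp_sub_le hC hn (by rw [hj, hψj, hμ0]; simp)
      (fun k h1 h2 => (hψk k h1 h2).1) (fun k h1 h2 => (hψk k h1 h2).2) hμ he0 he m le_rfl
    have := norm_pauliX_gate_add_le (θ m) hdisj key (hZi ψ hψi) hcos
    rw [hsin, Complex.ofReal_one, one_smul] at this
    rwa [chainOp, act_mul, hi]
  -- Flipping `j` changes only the starting magnetization, to `-1`. Since the sine is odd, the whole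
  -- trajectory is mirrored with the same errors, and the last gate turns `i` to the other
  -- eigenstate.
  · set χ := act (pauliX j) ψ with hχ
    have hXj : (pauliX j : QubitOp Λ) = spin 1 (C 0) := by
      rw [hj, spin_singleton, pauliX, pauliString_single]
    have hcomm : ∀ p, ∀ k, 1 ≤ k → k ≤ m + 1 → Commute (spin p (C k)) (pauliX j) := by
      intro p k h1 h2
      rw [hXj]
      exact spin_commute (hC k h2 0 (by omega) (by omega)) p 1
    have hZX : spin 3 {j} * pauliX j = -(pauliX j * spin 3 {j} : QubitOp Λ) := by
      rw [pauliX, pauliString_single, spin_singleton, siteOp_mul, siteOp_mul, ← neg_one_smul ℂ,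
        ← siteOp_smul]
      congr 1
      ext a b; fin_cases a <;> fin_cases b <;> simp [pauli, Matrix.mul_apply]
    have hχ0 : act (spin 3 (C 0)) χ = ((-μ 0 : ℝ) : ℂ) • χ := by
      rw [hj, hχ, ← act_mul, hZX, ← neg_one_smul ℂ, act_smul, act_mul, hψj, hμ0]
      simp
    have hXu := pauliX_mem_unitary j
    have key := norm_act_chainOp_sub_le (μ := fun k => -μ k) hC hn hχ0
      (fun k h1 h2 => by
        rw [hχ, ← act_mul, (hcomm 3 k h1 (by omega)).eq, act_mul, norm_act_of_mem_unitary hXu]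
        exact (hψk k h1 h2).1)
      (fun k h1 h2 => by
        rw [hχ, ← act_mul, (hcomm 1 k h1 (by omega)).eq, act_mul, ← act_vec_smul, ← act_vec_sub,
          norm_act_of_mem_unitary hXu]
        exact (hψk k h1 h2).2)
      (fun k hk => by rw [mul_neg, Real.sin_neg, hμ k hk]; ring) he0
      (fun k hk => by rw [mul_neg, Real.sin_neg, abs_neg]; exact he k hk) m le_rfl
    have hχi : act (spin 3 {i}) χ = χ := by
      have := hcomm 3 (m + 1) (by omega) le_rfl
      rw [hi] at this
      rw [hχ, ← act_mul, this.eq, act_mul, hψi]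
    have := norm_pauliX_gate_add_le (θ m) hdisj key (hZi χ hχi)
      (by rw [mul_neg, Real.cos_neg, hcos])
    rw [mul_neg, Real.sin_neg, hsin, Complex.ofReal_neg, Complex.ofReal_one, neg_one_smul,
      ← sub_eq_add_neg] at this
    rwa [chainOp, act_mul, hi]

end Chain

/-! ### Realizing the gates by bounded two-body couplings -/

section Couplings

/-- The Pauli string `Z_a Y_b`. -/
def pairString (a b : Λ) : Λ → Fin 4 := Function.update (Pi.single a 3) b 2

lemma pauliString_pairString {a b : Λ} (hab : a ≠ b) :
    pauliString (pairString a b) = siteOp a (pauli 3) * siteOp b (pauli 2) := by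
  rw [siteOp, siteOp, tensorOp_mul, pauliString_eq_tensorOp]
  congr 1
  funext c
  by_cases hcb : c = b
  · subst hcb
    simp [pairString, Pi.mulSingle_eq_of_ne hab.symm]
  · by_cases hca : c = a
    · subst hca
      simp [pairString, hcb]
    · simp only [pairString, Function.update_of_ne hcb, Pi.single_eq_of_ne hca, Pi.mul_apply,
        Pi.mulSingle_eq_of_ne hca, Pi.mulSingle_eq_of_ne hcb, mul_one]
      rfl

lemma mem_pauliSupport {P : Λ → Fin 4} {c : Λ} : c ∈ pauliSupport P ↔ P c ≠ 0 := by
  simp [pauliSupport]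

lemma mem_pauliSupport_pairString {a b c : Λ} :
    c ∈ pauliSupport (pairString a b) ↔ c = a ∨ c = b := by
  rw [mem_pauliSupport, pairString]
  by_cases hcb : c = b
  · subst hcb; simp
  · by_cases hca : c = a
    · subst hca; simp [hcb]
    · simp [hcb, hca]

lemma pairString_injOn {D E : Finset Λ} (h : Disjoint D E) :
    Set.InjOn (fun p : Λ × Λ => pairString p.1 p.2) (D ×ˢ E : Finset (Λ × Λ)) := by
  rintro ⟨a, b⟩ hp ⟨a', b'⟩ hp' heq
  rw [Finset.coe_product, Set.mem_prod] at hp hp'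
  simp only [Finset.mem_coe] at hp hp' heq
  have ha : a ∈ pauliSupport (pairString a' b') :=
    heq ▸ mem_pauliSupport_pairString.mpr (Or.inl rfl)
  have hb : b ∈ pauliSupport (pairString a' b') :=
    heq ▸ mem_pauliSupport_pairString.mpr (Or.inr rfl)
  rw [mem_pauliSupport_pairString] at ha hb
  have ha' : a = a' := ha.resolve_right fun e =>
    Finset.disjoint_left.mp h hp.1 (e ▸ hp'.2)
  have hb' : b = b' := hb.resolve_left fun e =>
    Finset.disjoint_left.mp h (e ▸ hp'.1) hp.2
  rw [ha', hb']

/-- The coefficients of the Hamiltonian `g Σ Z_a Y_b`, the sum running over `a ∈ D`, `b ∈ E`. -/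
def coupling (g : ℝ) (D E : Finset Λ) (P : Λ → Fin 4) : ℝ :=
  if P ∈ (D ×ˢ E).image fun p => pairString p.1 p.2 then g else 0

lemma sum_coupling_smul (g : ℝ) {D E : Finset Λ} (h : Disjoint D E) :
    ∑ P, (coupling g D E P : ℂ) • pauliString P = (g : ℂ) • (spin 3 D * spin 2 E) := by
  have h1 : ∀ P, (coupling g D E P : ℂ) • pauliString P =
      if P ∈ (D ×ˢ E).image fun p => pairString p.1 p.2 then (g : ℂ) • pauliString P else 0 := by
    intro P
    rw [coupling]
    split_ifs <;> simp
  simp only [h1]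
  rw [Finset.sum_ite_mem, Finset.univ_inter, Finset.sum_image (pairString_injOn h),
    Finset.sum_product, spin, spin, Finset.sum_mul_sum, Finset.smul_sum]
  refine Finset.sum_congr rfl fun a ha => ?_
  rw [Finset.smul_sum]
  refine Finset.sum_congr rfl fun b hb => ?_
  rw [pauliString_pairString (ne_of_mem_of_not_mem hb (Finset.disjoint_left.mp h ha)).symm]

/-- The coefficients of the `K`-local Hamiltonians whose pair interactions are bounded by `r`. -/
def boundedCouplings (K : ℕ) (r : Λ → Λ → ℝ) : Set ((Λ → Fin 4) → ℝ) :=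
  {c | (∀ P, K < (pauliSupport P).card → c P = 0) ∧ ∀ i j, i ≠ j →
    ‖∑ P ∈ Finset.univ.filter (fun P : Λ → Fin 4 => i ∈ pauliSupport P ∧ j ∈ pauliSupport P),
      (c P : ℂ) • pauliString P‖ ≤ r i j}

lemma zero_mem_boundedCouplings (K : ℕ) {r : Λ → Λ → ℝ} (hr : ∀ i j, 0 ≤ r i j) :
    (0 : (Λ → Fin 4) → ℝ) ∈ boundedCouplings K r := by
  refine ⟨fun _ _ => rfl, fun i j _ => ?_⟩
  simpa using hr i j

/-- At most one string `Z_a Y_b` with `a ∈ D`, `b ∈ E` contains two given sites, because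
disjointness decides which of them carries Z. Each pair part is therefore a single term of norm at
most `|g|`. -/
lemma coupling_mem_boundedCouplings {g : ℝ} {D E : Finset Λ} (h : Disjoint D E) {r : Λ → Λ → ℝ}
    (hr : ∀ i j, 0 ≤ r i j) (hsymm : ∀ i j, r i j = r j i)
    (hg : ∀ a ∈ D, ∀ b ∈ E, |g| ≤ r a b) : coupling g D E ∈ boundedCouplings 2 r := by
  have hne : ∀ P, coupling g D E P ≠ 0 → ∃ a ∈ D, ∃ b ∈ E, P = pairString a b := by
    intro P hP
    rw [coupling, ite_ne_right_iff, Finset.mem_image] at hP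
    obtain ⟨⟨⟨a, b⟩, hp, rfl⟩, -⟩ := hP
    rw [Finset.mem_product] at hp
    exact ⟨a, hp.1, b, hp.2, rfl⟩
  refine ⟨fun P hP => ?_, fun i j hij => ?_⟩
  · by_contra hc
    obtain ⟨a, -, b, -, rfl⟩ := hne P hc
    have : pauliSupport (pairString a b) ⊆ {a, b} := by
      intro c hc
      simpa using mem_pauliSupport_pairString.mp hc
    have := (Finset.card_le_card this).trans Finset.card_le_two
    omega
  · obtain ⟨P₀, hP₀⟩ : ∃ P₀, ∀ P, i ∈ pauliSupport P → j ∈ pauliSupport P →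
        coupling g D E P ≠ 0 → P = P₀ := by
      by_cases hiD : i ∈ D
      · refine ⟨pairString i j, fun P hi hj hP => ?_⟩
        obtain ⟨a, ha, b, hb, rfl⟩ := hne P hP
        rw [mem_pauliSupport_pairString] at hi hj
        rcases hi with rfl | rfl
        · rw [hj.resolve_left hij.symm]
        · exact absurd hb (Finset.disjoint_left.mp h hiD)
      · refine ⟨pairString j i, fun P hi hj hP => ?_⟩
        obtain ⟨a, ha, b, hb, rfl⟩ := hne P hP
        rw [mem_pauliSupport_pairString] at hi hj
        rcases hi with rfl | rfl
        · exact absurd ha hiD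
        · rw [hj.resolve_right hij.symm]
    refine (norm_sum_le _ _).trans ?_
    have hterm : ∀ P ∈ Finset.univ.filter
        (fun P : Λ → Fin 4 => i ∈ pauliSupport P ∧ j ∈ pauliSupport P),
        ‖(coupling g D E P : ℂ) • pauliString P‖ ≤ if P = P₀ then r i j else 0 := by
      intro P hP
      rw [Finset.mem_filter] at hP
      rw [norm_smul, norm_pauliString, mul_one, Complex.norm_real, Real.norm_eq_abs]
      by_cases hc : coupling g D E P = 0
      · rw [hc, abs_zero]
        split_ifs
        · exact hr i j
        · exact le_rfl
      · rw [if_pos (hP₀ P hP.2.1 hP.2.2 hc)]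
        obtain ⟨a, ha, b, hb, rfl⟩ := hne P hc
        have hle : |coupling g D E (pairString a b)| ≤ |g| := by
          rw [coupling]
          split_ifs
          · exact le_rfl
          · simp
        obtain ⟨-, hi, hj⟩ := hP
        rw [mem_pauliSupport_pairString] at hi hj
        rcases hi with rfl | rfl
        · rw [hj.resolve_left hij.symm]
          exact hle.trans (hg _ ha _ hb)
        · rw [hj.resolve_right hij.symm, hsymm]
          exact hle.trans (hg _ ha _ hb)
    refine (Finset.sum_le_sum hterm).trans ?_
    refine (Finset.sum_le_sum_of_subset_of_nonneg (Finset.subset_univ _) fun P _ _ => ?_).trans ?_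
    · split_ifs
      · exact hr i j
      · exact le_rfl
    · simp

/-- The coupling `-(θ / τ)` is kept on for time `τ`; its sign cancels that of `exp (-i H τ)`. -/
lemma reaches_gate {r : Λ → Λ → ℝ} (hr : ∀ i j, 0 ≤ r i j) (hsymm : ∀ i j, r i j = r j i)
    {D E : Finset Λ} (h : Disjoint D E) {θ τ : ℝ} (hτ : 0 < τ) (hθ : 0 ≤ θ)
    (hg : ∀ a ∈ D, ∀ b ∈ E, θ / τ ≤ r a b) :
    Reaches (boundedCouplings 2 r) τ (gate θ D E) := by
  have hmem := coupling_mem_boundedCouplings (g := -(θ / τ)) h hr hsymm fun a ha b hb => by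
    rw [abs_neg, abs_of_nonneg (by positivity)]
    exact hg a ha b hb
  have := reaches_const hmem τ
  rw [sum_coupling_smul _ h] at this
  convert this using 1
  rw [gate, ← Complex.coe_smul τ, smul_smul, smul_smul]
  congr 2
  push_cast
  have : (τ : ℂ) ≠ 0 := by exact_mod_cast hτ.ne'
  field_simp

lemma reaches_chainOp {r : Λ → Λ → ℝ} (hr : ∀ i j, 0 ≤ r i j) (hsymm : ∀ i j, r i j = r j i)
    {C : ℕ → Finset Λ} {m : ℕ} (hC : ∀ k ≤ m, ∀ l ≤ m, k ≠ l → Disjoint (C k) (C l))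
    {θ : ℕ → ℝ} {τ : ℝ} (hτ : 0 < τ) (hθ : ∀ k, 0 ≤ θ k)
    (hg : ∀ k < m, ∀ a ∈ C k, ∀ b ∈ C (k + 1), θ k / τ ≤ r a b) :
    ∀ k ≤ m, Reaches (boundedCouplings 2 r) (k * τ) (chainOp θ C k)
  | 0, _ => by
    have := reaches_const (zero_mem_boundedCouplings (Λ := Λ) 2 hr) 0
    simpa [chainOp] using this
  | k + 1, hk => by
    have h1 := reaches_chainOp hr hsymm hC hτ hθ hg k (by omega)
    have h2 := reaches_gate hr hsymm (hC k (by omega) (k + 1) hk (by omega)) hτ (hθ k)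
      (hg k (by omega))
    have := h1.trans h2 (by positivity) hτ.le
    rw [chainOp]
    convert this using 1
    push_cast
    ring

end Couplings

/-! ### Specialization to power-law couplings on the lattice -/

section Lattice

variable {d L : ℕ}

lemma siteDist_comm (a b : Site d L) : siteDist a b = siteDist b a := by
  simp only [siteDist]
  congr 1
  exact Finset.sum_congr rfl fun k _ => by ring

lemma canGrow_of_reaches {α T : ℝ} {K : ℕ} {V : QubitOp (Site d L)} {i j : Site d L}
    (h : Reaches (boundedCouplings K fun a b : Site d L => siteDist a b ^ (-α)) T V)
    (hV : 1 ≤ ‖(Vᴴ * pauliX i * V) * pauliX j - pauliX j * (Vᴴ * pauliX i * V)‖) :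
    CanGrow α K T i j := by
  obtain ⟨J, U, hJ, hU, rfl⟩ := h
  exact ⟨J, U, ⟨fun t ht => (hJ t ht).1, fun t ht => (hJ t ht).2⟩, hU, hV⟩

end Lattice

end Qubits

/-! ### Placing the clusters in the cube -/

section Geometry

/-- Subsets of size `q` are peeled off one at a time. Beyond index `m` the family is empty, which
makes disjointness unconditional. -/
lemma exists_disjoint_family {β : Type*} [DecidableEq β] (q : ℕ) :
    ∀ (m : ℕ) (A : Finset β), m * q ≤ A.card → ∃ G : ℕ → Finset β, (∀ k, G k ⊆ A) ∧
      (∀ k < m, (G k).card = q) ∧ ∀ k l, k ≠ l → Disjoint (G k) (G l)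
  | 0, _, _ => ⟨fun _ => ∅, by simp⟩
  | m + 1, A, hA => by
    obtain ⟨B, hB, hBq⟩ := Finset.exists_subset_card_eq (show q ≤ A.card by nlinarith)
    obtain ⟨G, hG, hGq, hGd⟩ := exists_disjoint_family q m (A \ B) (by
      rw [Finset.card_sdiff_of_subset hB, hBq]
      have : (m + 1) * q = m * q + q := by ring
      omega)
    have hGB : ∀ k, Disjoint B (G k) := fun k =>
      Finset.disjoint_of_subset_right (hG k) Finset.disjoint_sdiff
    refine ⟨fun k => if k = m then B else if k < m then G k else ∅, ?_, ?_, ?_⟩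
    · intro k
      dsimp only
      split_ifs
      · exact hB
      · exact (hG k).trans Finset.sdiff_subset
      · simp
    · intro k hk
      dsimp only
      split_ifs with h1 h2
      · exact hBq
      · exact hGq k h2
      · omega
    · intro k l hkl
      dsimp only
      split_ifs with h1 h2 h3 h4 h5
      · omega
      · exact hGB l
      · simp
      · exact (hGB k).symm
      · exact hGd k l hkl
      · simp
      · simp
      · simp
      · simp

variable {d L : ℕ}

/-- The lower (`false`) or upper (`true`) half of the lattice in the direction `o`. -/
def half (o : Fin d) (s : Bool) : Finset (Site d L) :=
  Finset.univ.filter fun a => if s then L ≤ 2 * (a o : ℕ) else 2 * (a o : ℕ) < L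

/-- The lower (`false`) or upper (`true`) quarter of the lattice in the direction `o`. -/
def slab (o : Fin d) (s : Bool) : Finset (Site d L) :=
  Finset.univ.filter fun a => if s then 3 * L < 4 * (a o : ℕ) + 4 else 4 * (a o : ℕ) < L

lemma slab_subset_half (hL : 3 ≤ L) (o : Fin d) (s : Bool) :
    (slab o s : Finset (Site d L)) ⊆ half o s := by
  intro a ha
  cases s <;> simp [slab, half] at ha ⊢ <;> omega

lemma disjoint_half (o : Fin d) : Disjoint (half o false : Finset (Site d L)) (half o true) := by
  rw [Finset.disjoint_left]
  intro a ha hb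
  simp [half] at ha hb
  omega

lemma le_card_slab (o : Fin d) (s : Bool) : L ^ d ≤ 4 * (slab o s : Finset (Site d L)).card := by
  set F : Finset (Fin L) :=
    Finset.univ.filter fun y => if s then 3 * L < 4 * (y : ℕ) + 4 else 4 * (y : ℕ) < L with hF
  have hFcard : L ≤ 4 * F.card := by
    have hlow : L ≤ 4 * (Finset.univ.filter fun y : Fin L => 4 * (y : ℕ) < L).card := by
      have hq : (L + 3) / 4 ≤ (Finset.univ.filter fun y : Fin L => 4 * (y : ℕ) < L).card := by
        have hinj : Function.Injective fun t : Fin ((L + 3) / 4) =>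
            (⟨t, by have := t.2; omega⟩ : Fin L) := fun s t hst => by
          simpa [Fin.ext_iff] using hst
        rw [← Fintype.card_fin ((L + 3) / 4), ← Finset.card_univ,
          ← Finset.card_image_of_injective _ hinj]
        refine Finset.card_le_card fun y hy => ?_
        rw [Finset.mem_image] at hy
        obtain ⟨t, -, rfl⟩ := hy
        have := t.2
        simp only [Finset.mem_filter, Finset.mem_univ, true_and]
        omega
      omega
    cases s
    · simpa [hF] using hlow
    · refine hlow.trans (Nat.mul_le_mul_left 4 ?_)
      -- The upper quarter is the mirror image of the lower one, so the same count applies.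
      rw [← Finset.card_image_of_injective _ Fin.rev_injective]
      refine Finset.card_le_card fun y hy => ?_
      rw [Finset.mem_image] at hy
      obtain ⟨t, ht, rfl⟩ := hy
      have := t.2
      simp only [Finset.mem_filter, Finset.mem_univ, true_and, hF, if_true, Fin.val_rev] at ht ⊢
      omega
  have hslab : (slab o s : Finset (Site d L)) =
      Fintype.piFinset (Function.update (fun _ => Finset.univ) o F) := by
    ext a
    simp only [slab, hF, Fintype.mem_piFinset, Finset.mem_filter, Finset.mem_univ, true_and]
    constructor
    · intro ha k
      by_cases hk : k = o
      · subst hk; simpa using ha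
      · simp [hk]
    · intro ha
      simpa using ha o
  have hd : d = (d - 1) + 1 := by have := o.2; omega
  rw [hslab, Fintype.card_piFinset, ← Finset.mul_prod_erase _ _ (Finset.mem_univ o),
    Function.update_self]
  have : ∏ k ∈ Finset.univ.erase o,
      ((Function.update (fun _ => Finset.univ) o F : Fin d → Finset (Fin L)) k).card =
      L ^ (d - 1) := by
    rw [Finset.prod_congr rfl fun k hk => by
      rw [Function.update_of_ne (Finset.ne_of_mem_erase hk)]]
    simp
  rw [this, ← mul_assoc]
  calc L ^ d = L * L ^ (d - 1) := by rw [← pow_succ', ← hd]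
    _ ≤ _ := Nat.mul_le_mul_right _ hFcard

lemma abs_sub_le_siteDist (a b : Site d L) (k : Fin d) :
    |((a k : ℕ) : ℝ) - ((b k : ℕ) : ℝ)| ≤ siteDist a b := by
  rw [siteDist, ← Real.sqrt_sq_eq_abs]
  refine Real.sqrt_le_sqrt ?_
  exact Finset.single_le_sum (f := fun k => (((a k : ℕ) : ℝ) - ((b k : ℕ) : ℝ)) ^ 2)
    (fun k _ => sq_nonneg _) (Finset.mem_univ k)

lemma siteDist_le (a b : Site d L) : siteDist a b ≤ d * L := by
  rw [siteDist]
  refine Real.sqrt_le_iff.mpr ⟨by positivity, ?_⟩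
  have h1 : ∀ k ∈ (Finset.univ : Finset (Fin d)),
      (((a k : ℕ) : ℝ) - ((b k : ℕ) : ℝ)) ^ 2 ≤ (L : ℝ) ^ 2 := by
    intro k _
    have ha : ((a k : ℕ) : ℝ) ≤ L := by exact_mod_cast (a k).2.le
    have hb : ((b k : ℕ) : ℝ) ≤ L := by exact_mod_cast (b k).2.le
    have ha0 : (0 : ℝ) ≤ ((a k : ℕ) : ℝ) := by positivity
    have hb0 : (0 : ℝ) ≤ ((b k : ℕ) : ℝ) := by positivity
    exact sq_le_sq' (by linarith) (by linarith)
  refine (Finset.sum_le_sum h1).trans ?_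
  rw [Finset.sum_const, Finset.card_univ, Fintype.card_fin, nsmul_eq_mul, mul_pow]
  have : (d : ℝ) ≤ (d : ℝ) ^ 2 := by exact_mod_cast Nat.le_self_pow two_ne_zero d
  gcongr

lemma le_siteDist_of_mem_slab (hL : 8 ≤ L) (o : Fin d) (s : Bool) {a b : Site d L}
    (ha : a ∈ half o s) (hb : b ∈ slab o (!s)) : (L : ℝ) / 8 ≤ siteDist a b := by
  refine le_trans ?_ (abs_sub_le_siteDist a b o)
  cases s
  · simp [half, slab] at ha hb
    have : (L : ℝ) + 8 * ((a o : ℕ) : ℝ) ≤ 8 * ((b o : ℕ) : ℝ) := by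
      exact_mod_cast (by omega : L + 8 * (a o : ℕ) ≤ 8 * (b o : ℕ))
    rw [abs_sub_comm]
    exact le_trans (by linarith) (le_abs_self _)
  · simp [half, slab] at ha hb
    have : (L : ℝ) + 8 * ((b o : ℕ) : ℝ) ≤ 8 * ((a o : ℕ) : ℝ) := by
      exact_mod_cast (by omega : L + 8 * (b o : ℕ) ≤ 8 * (a o : ℕ))
    exact le_trans (by linarith) (le_abs_self _)

/-- The half of the lattice that contains the site `a`. -/
def side (o : Fin d) (a : Site d L) : Bool := decide (L ≤ 2 * (a o : ℕ))

lemma mem_half_side (o : Fin d) (a : Site d L) : a ∈ half o (side o a) := by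
  by_cases h : L ≤ 2 * (a o : ℕ)
  · simp [half, side, h]
  · simp [half, side, h]; omega

/-- A chain of `m` clusters of size `q` from `j` to `i`, such that consecutive clusters have a
distance proportional to `L`: the clusters alternate between the two outer quarters. -/
lemma exists_chain (hL : 8 ≤ L) (o : Fin d) {m q : ℕ} (hm : 1 ≤ m)
    (hq : 4 * ((m + 1) * q + 2) ≤ L ^ d) {i j : Site d L} (hij : i ≠ j)
    (hside : side o i = xor (side o j) (decide (Odd (m + 1)))) :
    ∃ C : ℕ → Finset (Site d L), C 0 = {j} ∧ C (m + 1) = {i} ∧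
      (∀ k ≤ m + 1, ∀ l ≤ m + 1, k ≠ l → Disjoint (C k) (C l)) ∧
      (∀ k, 1 ≤ k → k ≤ m → (C k).card = q) ∧
      ∀ k < m + 1, ∀ a ∈ C k, ∀ b ∈ C (k + 1), (L : ℝ) / 8 ≤ siteDist a b := by
  -- Each outer quarter receives a full family, so that cluster `k` can be taken from whichever side
  -- its parity demands. Indices `0` to `m` are covered, though index `0` goes to `j`.
  have hfam : ∀ s, ∃ G : ℕ → Finset (Site d L), (∀ k, G k ⊆ slab o s \ {i, j}) ∧
      (∀ k < m + 1, (G k).card = q) ∧ ∀ k l, k ≠ l → Disjoint (G k) (G l) := by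
    intro s
    refine exists_disjoint_family q (m + 1) _ ?_
    have h1 := le_card_slab (L := L) o s
    have h2 := Finset.le_card_sdiff {i, j} (slab o s : Finset (Site d L))
    have h3 : ({i, j} : Finset (Site d L)).card ≤ 2 := Finset.card_le_two
    omega
  choose G hG hGq hGd using hfam
  set s : ℕ → Bool := fun k => xor (side o j) (decide (Odd k)) with hs
  have hs1 : ∀ k, s (k + 1) = !(s k) := by
    intro k
    by_cases hk : Odd k
    · have : ¬ Odd (k + 1) := by rw [Nat.odd_add_one]; simpa using hk
      simp [hs, hk, this]
    · have : Odd (k + 1) := by rw [Nat.odd_add_one]; exact hk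
      simp [hs, hk, this]
  set C : ℕ → Finset (Site d L) := fun k =>
    if k = 0 then {j} else if k = m + 1 then {i} else G (s k) k with hCdef
  have hC0 : C 0 = {j} := by simp [hCdef]
  have hC1 : C (m + 1) = {i} := by simp [hCdef]
  have hCk : ∀ k, 1 ≤ k → k ≤ m → C k = G (s k) k := by
    intro k h1 h2
    simp only [hCdef]
    rw [if_neg (by omega), if_neg (by omega)]
  have hslab : ∀ k, 1 ≤ k → k ≤ m → C k ⊆ slab o (s k) := fun k h1 h2 => by
    rw [hCk k h1 h2]; exact (hG _ k).trans Finset.sdiff_subset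
  have hhalf : ∀ k ≤ m + 1, C k ⊆ half o (s k) := by
    intro k hk
    rcases Nat.eq_zero_or_pos k with rfl | h0
    · rw [hC0, Finset.singleton_subset_iff]
      have : s 0 = side o j := by simp [hs]
      rw [this]
      exact mem_half_side o j
    · rcases Nat.lt_or_ge m k with h1 | h1
      · have : k = m + 1 := by omega
        subst this
        rw [hC1, Finset.singleton_subset_iff]
        have : s (m + 1) = side o i := hside.symm
        rw [this]
        exact mem_half_side o i
      · exact (hslab k h0 h1).trans (slab_subset_half (by omega) o _)
  have hdisj : ∀ k l, k < l → l ≤ m + 1 → Disjoint (C k) (C l) := by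
    intro k l hkl hl
    have hnot : ∀ k, 1 ≤ k → k ≤ m → i ∉ C k ∧ j ∉ C k := by
      intro k h1 h2
      rw [hCk k h1 h2]
      constructor <;> intro hmem <;> have := hG _ k hmem <;> simp at this
    rcases Nat.eq_zero_or_pos k with rfl | h0
    · rw [hC0, Finset.disjoint_singleton_left]
      rcases Nat.lt_or_ge m l with h1 | h1
      · have : l = m + 1 := by omega
        rw [this, hC1, Finset.mem_singleton]
        exact hij.symm
      · exact (hnot l (by omega) h1).2
    · rcases Nat.lt_or_ge m l with h1 | h1
      · have : l = m + 1 := by omega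
        rw [this, hC1, Finset.disjoint_singleton_right]
        exact (hnot k h0 (by omega)).1
      · by_cases hss : s k = s l
        · rw [hCk k h0 (by omega), hCk l (by omega) h1, hss]
          exact hGd _ k l (by omega)
        · refine Finset.disjoint_of_subset_left (hhalf k (by omega))
            (Finset.disjoint_of_subset_right (hhalf l (by omega)) ?_)
          have := disjoint_half (L := L) o
          cases h2 : s k <;> cases h3 : s l
          · simp [h2, h3] at hss
          · exact this
          · exact this.symm
          · simp [h2, h3] at hss
  refine ⟨C, hC0, hC1, ?_, ?_, ?_⟩
  · intro k hk l hl hkl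
    rcases Nat.lt_or_gt_of_ne hkl with h | h
    · exact hdisj k l h hl
    · exact (hdisj l k h hk).symm
  · intro k h1 h2
    rw [hCk k h1 h2]
    exact hGq _ k (by omega)
  -- Of two consecutive sets at least one is an intermediate cluster, as `1 ≤ m`. It lies in an
  -- outer quarter and the other set in the opposite half.
  · intro k hk a ha b hb
    rcases Nat.lt_or_ge k m with h1 | h1
    · have h2 := hslab (k + 1) (by omega) (by omega) hb
      rw [hs1] at h2
      exact le_siteDist_of_mem_slab hL o _ (hhalf k (by omega) ha) h2
    · have h2 := hslab k (by omega) (by omega) ha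
      have h3 := hhalf (k + 1) (by omega) hb
      rw [siteDist_comm]
      refine le_siteDist_of_mem_slab hL o _ h3 ?_
      rw [hs1, Bool.not_not]
      exact h2

/-- For `α ≥ 0` the worst case is the largest distance, at most `d L`. For `α ≤ 0` it is the
smallest, which is why neighbouring clusters are kept `L / 8` apart. -/
lemma le_siteDist_rpow (hd : 0 < d) (hL : 0 < L) (α : ℝ) {a b : Site d L}
    (h : (L : ℝ) / 8 ≤ siteDist a b) :
    min ((d : ℝ) ^ (-α)) ((1 / 8 : ℝ) ^ (-α)) * (L : ℝ) ^ (-α) ≤ siteDist a b ^ (-α) := by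
  have hL' : (0 : ℝ) < L := by exact_mod_cast hL
  have hd' : (0 : ℝ) < d := by exact_mod_cast hd
  have hpos : 0 < siteDist a b := lt_of_lt_of_le (by positivity) h
  have hLα : (0 : ℝ) ≤ (L : ℝ) ^ (-α) := by positivity
  rcases le_total 0 α with hα | hα
  · calc _ ≤ (d : ℝ) ^ (-α) * (L : ℝ) ^ (-α) :=
          mul_le_mul_of_nonneg_right (min_le_left _ _) hLα
      _ = ((d : ℝ) * L) ^ (-α) := (Real.mul_rpow hd'.le hL'.le).symm
      _ ≤ _ := Real.rpow_le_rpow_of_nonpos hpos (siteDist_le a b) (by linarith)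
  · calc _ ≤ (1 / 8 : ℝ) ^ (-α) * (L : ℝ) ^ (-α) :=
          mul_le_mul_of_nonneg_right (min_le_right _ _) hLα
      _ = (1 / 8 * L : ℝ) ^ (-α) := (Real.mul_rpow (by norm_num) hL'.le).symm
      _ ≤ _ := Real.rpow_le_rpow (by positivity) (by linarith) (by linarith)

end Geometry

/-! ### Asymptotics in the number of qubits -/

section Growth

open Filter

lemma tendsto_numQubits {d : ℕ} (hd : 0 < d) :
    Tendsto (fun L : ℕ => numQubits d L) atTop atTop :=
  (tendsto_pow_atTop hd.ne').comp tendsto_natCast_atTop_atTop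

/-- Chains with `m` clusters allow operators to grow in time `N ^ (α / d - 1 + δ)` for any
`δ > 1 / (m + 1)`, if the parity of `m` fits to the positions of the end points. -/
lemma exists_canGrow_of_side {d : ℕ} (hd : 0 < d) (α : ℝ) {m : ℕ} (hm : 1 ≤ m) {δ : ℝ}
    (hδ : ((m + 1 : ℕ) : ℝ)⁻¹ < δ) :
    ∃ L₀ : ℕ, ∀ L : ℕ, L₀ ≤ L → ∀ i j : Site d L, i ≠ j →
      side ⟨0, hd⟩ i = xor (side ⟨0, hd⟩ j) (decide (Odd (m + 1))) →
        CanGrow α 2 (numQubits d L ^ (α / d - 1 + δ)) i j := by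
  set M : ℝ := ((m + 1 : ℕ) : ℝ) with hM
  have hM0 : 0 < M := by rw [hM]; positivity
  -- `W` brings the polarization error down to `1 / 16`, and `x₀` does the same for the noise `4 W /
  -- x`, both including the factor `2 ^ m`.
  set W : ℕ := (32 * 2 ^ m) ^ 2 with hW
  set x₀ : ℝ := max 2 (64 * W * 2 ^ m) with hx₀
  set c : ℝ := 1 / (32 * M) with hc
  have hc0 : 0 < c := by positivity
  have hd' : (0 : ℝ) < d := by exact_mod_cast hd
  set g₀ : ℝ := min ((d : ℝ) ^ (-α)) ((1 / 8 : ℝ) ^ (-α)) with hg₀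
  have hg₀0 : 0 < g₀ := lt_min (by positivity) (by positivity)
  have hev : ∀ᶠ N : ℝ in atTop, x₀ ^ (m + 1) ≤ c * N ∧ 32 * M ≤ N ∧
      2 ^ m * M / (c * g₀) ≤ N ^ (δ - M⁻¹) := by
    refine ((tendsto_id.const_mul_atTop hc0).eventually_ge_atTop _).and
      ((eventually_ge_atTop _).and
        ((tendsto_rpow_atTop (by linarith)).eventually_ge_atTop _))
  obtain ⟨L₀, hL₀⟩ := eventually_atTop.mp
    (((tendsto_numQubits hd).eventually hev).and (eventually_ge_atTop 8))
  refine ⟨L₀, fun L hL i j hij hside => ?_⟩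
  obtain ⟨⟨hN1, hN2, hN3⟩, hL8⟩ := hL₀ L hL
  set N := numQubits d L with hN
  have hN0 : 0 < N := lt_of_lt_of_le (by positivity) hN2
  have hNL : N = ((L ^ d : ℕ) : ℝ) := by rw [hN, numQubits]; push_cast; rfl
  -- Small enough that `m + 1` clusters of `2 * h` sites, with two sites to spare, fit into a
  -- quarter of the cube, yet still proportional to `N`.
  set h : ℕ := L ^ d / (32 * (m + 1)) with hh
  have hN2' : 32 * (m + 1) ≤ L ^ d := by
    rw [hNL, hM] at hN2
    exact_mod_cast hN2
  have hh1 : 1 ≤ h := (Nat.one_le_div_iff (by positivity)).mpr hN2'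
  have hhle : 32 * (m + 1) * h ≤ L ^ d := Nat.mul_div_le _ _
  have hhlt : L ^ d < 32 * (m + 1) * (h + 1) := Nat.lt_mul_div_succ _ (by positivity)
  have hcN : c * N ≤ 2 * h := by
    have h1 : (L ^ d : ℕ) ≤ 32 * (m + 1) * (2 * h) :=
      hhlt.le.trans (Nat.mul_le_mul_left _ (by omega))
    have h2 : N ≤ 32 * M * (2 * h) := by
      rw [hNL, hM]; exact_mod_cast h1
    rw [hc, one_div, inv_mul_le_iff₀ (by positivity)]
    exact h2
  have h2hN : (2 * h : ℝ) ≤ N := by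
    have : 2 * h ≤ L ^ d := by nlinarith
    rw [hNL]; exact_mod_cast this
  have hq : 4 * ((m + 1) * (2 * h) + 2) ≤ L ^ d := by nlinarith
  obtain ⟨C, hC0, hC1, hCd, hCcard, hCdist⟩ := exists_chain hL8 ⟨0, hd⟩ hm hq hij hside
  have h2h : (0 : ℝ) < 2 * h := by positivity
  set x : ℝ := (2 * h : ℝ) ^ M⁻¹ with hx
  have hxn : x ^ (m + 1) = 2 * h := Real.rpow_inv_natCast_pow h2h.le (by omega)
  have hx0 : 0 < x := by positivity
  have hxx₀ : x₀ ≤ x := by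
    have h1 : x₀ ^ (m + 1) ≤ x ^ (m + 1) := by rw [hxn]; exact hN1.trans hcN
    exact le_of_pow_le_pow_left₀ (by omega) hx0.le h1
  have hx2 : 2 ≤ x := (le_max_left _ _).trans hxx₀
  have hxW : 64 * W * 2 ^ m ≤ x := (le_max_right _ _).trans hxx₀
  have hsmall : (2 * (2 * W) / x + 2 / √(W + 1)) * 2 ^ m ≤ 1 / 8 := by
    have h1 : 2 * (2 * W) / x * 2 ^ m ≤ 1 / 16 := by
      rw [div_mul_eq_mul_div, div_le_iff₀ hx0]
      linarith
    have h2 : (32 * 2 ^ m : ℝ) ≤ √(W + 1) := by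
      refine Real.le_sqrt_of_sq_le ?_
      rw [hW]
      push_cast
      linarith
    have h3 : 2 / √(W + 1) * 2 ^ m ≤ 1 / 16 := by
      rw [div_mul_eq_mul_div, div_le_iff₀ (by positivity)]
      linarith
    linarith [add_mul (2 * (2 * W) / x) (2 / √((W : ℝ) + 1)) (2 ^ m)]
  obtain ⟨θ, hθ, hcomm⟩ := exists_chainOp_commutator hCd hC0 hC1 hCcard hx2 hxn hsmall
  set T : ℝ := N ^ (α / d - 1 + δ) with hT
  have hT0 : 0 < T := by positivity
  have hr0 : ∀ a b : Site d L, 0 ≤ siteDist a b ^ (-α) := fun a b =>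
    Real.rpow_nonneg (Real.sqrt_nonneg _) _
  have hLα : (L : ℝ) ^ (-α) = N ^ (-(α / d)) := by
    rw [hN, numQubits, ← Real.rpow_natCast_mul (by positivity)]
    congr 1
    field_simp
  have hTL : N ^ (-(α / d)) * T = N ^ δ / N := by
    rw [hT, ← Real.rpow_add hN0, ← Real.rpow_sub_one hN0.ne']
    congr 1
    ring
  -- The time `T` is shared equally by the `M = m + 1` gates. The surplus `N ^ (δ - M⁻¹)` beats all
  -- constants.
  have hbound : 2 ^ m * x / (2 * h) / (T / M) ≤ g₀ * (L : ℝ) ^ (-α) := by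
    rw [div_div_eq_mul_div, div_le_iff₀ hT0, hLα, mul_assoc, hTL]
    have hxN : x ≤ N ^ M⁻¹ := Real.rpow_le_rpow h2h.le h2hN (by positivity)
    calc 2 ^ m * x / (2 * h) * M ≤ 2 ^ m * N ^ M⁻¹ / (c * N) * M := by gcongr
      _ = g₀ * (2 ^ m * M / (c * g₀) * N ^ M⁻¹ / N) := by field_simp
      _ ≤ g₀ * (N ^ (δ - M⁻¹) * N ^ M⁻¹ / N) := by gcongr
      _ = g₀ * (N ^ δ / N) := by rw [← Real.rpow_add hN0, sub_add_cancel]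
  have hreach := reaches_chainOp (r := fun a b : Site d L => siteDist a b ^ (-α)) hr0
    (fun a b => by rw [siteDist_comm]) hCd (div_pos hT0 hM0) (fun k => (hθ k).1)
    (fun k hk a ha b hb => by
      refine le_trans ?_ (le_siteDist_rpow hd (by omega) α (hCdist k hk a ha b hb))
      refine le_trans ?_ hbound
      have := (hθ k).2
      gcongr) (m + 1) le_rfl
  rw [mul_div_cancel₀ _ hM0.ne'] at hreach
  exact canGrow_of_reaches hreach hcomm

/-- The clusters alternate sides, so the positions of `i` and `j` dictate the parity of the chain.
Two consecutive lengths cover both cases. -/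
lemma exists_canGrow {d : ℕ} (hd : 0 < d) (α : ℝ) {δ : ℝ} (hδ : 0 < δ) :
    ∃ L₀ : ℕ, ∀ L : ℕ, L₀ ≤ L → ∀ i j : Site d L, i ≠ j →
      CanGrow α 2 (numQubits d L ^ (α / d - 1 + δ)) i j := by
  obtain ⟨m, hm⟩ := exists_nat_one_div_lt hδ
  have hlt : ∀ k, m < k → ((k + 1 : ℕ) : ℝ)⁻¹ < δ := by
    intro k hk
    refine lt_of_le_of_lt ?_ hm
    rw [one_div]
    have : (m : ℝ) ≤ k := by exact_mod_cast hk.le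
    gcongr
    push_cast
    linarith
  obtain ⟨L₁, h₁⟩ := exists_canGrow_of_side hd α (m := m + 1) (by omega) (hlt _ (by omega))
  obtain ⟨L₂, h₂⟩ := exists_canGrow_of_side hd α (m := m + 2) (by omega) (hlt _ (by omega))
  refine ⟨max L₁ L₂, fun L hL i j hij => ?_⟩
  by_cases hs : side ⟨0, hd⟩ i = xor (side ⟨0, hd⟩ j) (decide (Odd (m + 1 + 1)))
  · exact h₁ L ((le_max_left _ _).trans hL) i j hij hs
  · refine h₂ L ((le_max_right _ _).trans hL) i j hij ?_
    have hodd : decide (Odd (m + 2 + 1)) = !decide (Odd (m + 1 + 1)) := by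
      rw [← decide_not]
      exact decide_eq_decide.mpr Nat.odd_add_one
    rw [hodd]
    revert hs
    generalize side ⟨0, hd⟩ i = s
    generalize side ⟨0, hd⟩ j = t
    generalize decide (Odd (m + 1 + 1)) = u
    cases s <;> cases t <;> cases u <;> simp

lemma exists_site_ne {d L : ℕ} (hd : 0 < d) (hL : 2 ≤ L) : ∃ i j : Site d L, i ≠ j :=
  ⟨fun _ => ⟨0, by omega⟩, fun _ => ⟨1, by omega⟩, fun h => by
    simpa using congrFun h ⟨0, hd⟩⟩

end Growth

end PowerLawQubits

end

theorem corollary4 (d : ℕ) (hd : 0 < d) (α : ℝ) (hα : α < d) :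
    (∀ δ : ℝ, 0 < δ → ∃ K L₀ : ℕ, ∀ L : ℕ, L₀ ≤ L →
      ∀ i j : PowerLawQubits.Site d L, i ≠ j →
        PowerLawQubits.CanGrow α K (PowerLawQubits.numQubits d L ^ (α / d - 1 + δ)) i j) ∧
    (∀ β : ℝ, α / d - 1 < β → ∃ K : ℕ, ¬ PowerLawQubits.LiebRobinsonBound d α K β) := by
  refine ⟨fun δ hδ => ⟨2, PowerLawQubits.exists_canGrow hd α hδ⟩, fun β hβ => ⟨2, ?_⟩⟩
  rintro ⟨c, hc, L₁, hLR⟩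
  -- Half of the gap: growth is possible at `T = N ^ (β - δ)`, so the bound would force `c * N ^ δ ≤
  -- 1` for all large `L`.
  set δ := (β - (α / d - 1)) / 2 with hδ
  have hδ0 : 0 < δ := by rw [hδ]; linarith
  obtain ⟨L₀, hL₀⟩ := PowerLawQubits.exists_canGrow hd α hδ0
  have hN := PowerLawQubits.tendsto_numQubits hd
  obtain ⟨L, hL, hNc, hN1⟩ := ((Filter.eventually_ge_atTop (max (max L₀ L₁) 2)).and
    ((((tendsto_rpow_atTop hδ0).comp hN).eventually_gt_atTop c⁻¹).and
      (hN.eventually_ge_atTop 1))).exists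
  obtain ⟨i, j, hij⟩ := PowerLawQubits.exists_site_ne (d := d) hd ((le_max_right _ _).trans hL)
  have hN0 : 0 < PowerLawQubits.numQubits d L := by linarith
  have h1 := hLR L (((le_max_right _ _).trans (le_max_left _ _)).trans hL) i j hij _
    (by positivity) (hL₀ L (((le_max_left _ _).trans (le_max_left _ _)).trans hL) i j hij)
  have h2 : β = (α / d - 1 + δ) + δ := by rw [hδ]; ring
  rw [h2, Real.rpow_add hN0 (α / d - 1 + δ) δ, mul_left_comm] at h1
  have h3 : 0 < PowerLawQubits.numQubits d L ^ (α / d - 1 + δ) := by positivity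
  have h4 : c * PowerLawQubits.numQubits d L ^ δ ≤ 1 :=
    le_of_mul_le_mul_left (by rwa [mul_one]) h3
  have h5 : 1 < c * PowerLawQubits.numQubits d L ^ δ := by
    have := mul_lt_mul_of_pos_left hNc hc
    rwa [mul_inv_cancel₀ hc.ne'] at this
  linarith
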